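/- Let $\mathbb S^2\subset\mathbb R^3$ be the unit sphere with surface measure $\mu$ (total mass $4\pi$), and let $\mathbf L_2(\mathbb S^2)$ be the Hilbert space of square-integrable tangential vector fields $f:\mathbb S^2\to\mathbb R^3$ with $\langle f,g\rangle=\int f^\top g\,d\mu$. For each $\ell\ge 0$ let $\{Y_{\ell,k}\}_{k=1}^{2\ell+1}$ be an $L_2$-orthonormal basis of the real spherical harmonics of degree $\ell$, and for $\ell\ge1$ put $$\mathbf y_{\ell,k}=\frac{\mathbf L_*Y_{\ell,k}}{\sqrt{\ell(\ell+1)}},\qquad \mathbf z_{\ell,k}=\frac{\nabla_*Y_{\ell,k}}{\sqrt{\ell(\ell+1)}},$$ where $\nabla_*=(I-xx^\top)\nabla$ is the surface gradient and $\mathbf L_*=x\times\nabla$ the surface curl. A field $f\in\mathbf L_2(\mathbb S^2)$ is (weakly) divergence-free if $\langle f,\nabla_*g\rangle=0$, and (weakly) curl-free if $\langle f,\mathbf L_*g\rangle=0$, for all smooth $g$; let $\mathcal P_{\rm div}$, $\mathcal P_{\rm curl}$ be the orthogonal projections of $\mathbf L_2(\mathbb S^2)$ onto these two subspaces. Let $\phi\in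 C[0,\infty)$, $\rho\in(0,1)$, and let $\psi_\rho(x\cdot y)=C_\rho\,\phi(\rho^{-1}\|x-y\|)$, $x,y\in\mathbb S^2$, where the constant $C_\rho$ is such that $\int_{\mathbb S^2}\psi_\rho(x\cdot y)\,d\mu(x)=1$. With $P_\ell$ the Legendre polynomial normalized by $P_\ell(1)=1$, set $$\widehat\psi_\rho(\ell)=2\pi\int_{-1}^1\psi_\rho(t)P_\ell(t)\,dt,\qquad \kappa(t)=\frac1{4\pi(1-t^2)}\int_{-1}^t\bigl(1-4\pi\psi_\rho(s)\bigr)\,ds\quad(-1<t<1),$$ with $\kappa$ extended continuously to $[-1,1]$. With $t=x\cdot y$ define $$\Psi^{\rm div}_\rho(x,y)=-\kappa'(t)(x\times y)(x\times y)^\top+\kappa(t)\,(tI-yx^\top),$$ $$\Psi^{\rm curl}_\rho(x,y)=\kappa'(t)(y-tx)(x-ty)^\top+\kappa(t)\,(I-xx^\top)(I-yy^\top),$$ the terms with $\kappa'$ being read as $0$ when $y=\pm x$. Then for every $f\in\mathbf L_2(\mathbb S^2)$ and $x\in\mathbb S^2$ the integral $$(\mathcal C_{\Psi_\rho}f)(x)=\int_{\mathbb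 S^2}\bigl(\Psi^{\rm div}_\rho(x,y)+\Psi^{\rm curl}_\rho(x,y)\bigr)f(y)\,d\mu(y)$$ converges absolutely, $\mathcal C_{\Psi_\rho}$ is a bounded linear operator on $\mathbf L_2(\mathbb S^2)$, and it is a simple Fourier–Legendre multiplier: for all $\ell\ge1$ and $1\le k\le 2\ell+1$, $$\mathcal C_{\Psi_\rho}\mathbf y_{\ell,k}=\widehat\psi_\rho(\ell)\,\mathbf y_{\ell,k},\qquad \mathcal C_{\Psi_\rho}\mathbf z_{\ell,k}=\widehat\psi_\rho(\ell)\,\mathbf z_{\ell,k}$$ at every point of $\mathbb S^2$, and $\langle\mathcal C_{\Psi_\rho}f,\mathbf y_{\ell,k}\rangle=\widehat\psi_\rho(\ell)\langle f,\mathbf y_{\ell,k}\rangle$, $\langle\mathcal C_{\Psi_\rho}f,\mathbf z_{\ell,k}\rangle=\widehat\psi_\rho(\ell)\langle f,\mathbf z_{\ell,k}\rangle$ for every $f\in\mathbf L_2(\mathbb S^2)$. Consequently it preserves the Helmholtz–Hodge decomposition: for every $f\in\mathbf L_2(\mathbb S^2)$, $$\mathcal P_{\rm div}\,\mathcal C_{\Psi_\rho}f=\mathcal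 C_{\Psi_\rho}\mathcal P_{\rm div}f=\int_{\mathbb S^2}\Psi^{\rm div}_\rho(\cdot,y)f(y)\,d\mu(y),\qquad \mathcal P_{\rm curl}\,\mathcal C_{\Psi_\rho}f=\mathcal C_{\Psi_\rho}\mathcal P_{\rm curl}f=\int_{\mathbb S^2}\Psi^{\rm curl}_\rho(\cdot,y)f(y)\,d\mu(y).$$ -/

import Mathlib

open MeasureTheory Filter Topology
open scoped Matrix ENNReal ContDiff

noncomputable section

/-! ### The sphere, its surface measure, scalar and vector fields -/

/-- Euclidean three-space. -/
abbrev E3 : Type := EuclideanSpace ℝ (Fin 3)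

/-- The unit sphere of `ℝ³`. -/
abbrev S2 : Set E3 := Metric.sphere (0 : E3) 1

/-- The surface measure on the sphere (total mass `4π`). -/
abbrev sphereMeasure : Measure S2 := (volume : Measure E3).toSphere

/-- The cross product on Euclidean three-space. -/
def cross (x y : E3) : E3 := WithLp.toLp 2 (crossProduct x.ofLp y.ofLp)

/-- The extension of a function on the sphere that is constant along rays from the origin. -/
def radialExt (f : S2 → ℝ) (y : E3) : ℝ :=
  if h : y ≠ 0 then
    f ⟨‖y‖⁻¹ • y, by
      rw [mem_sphere_zero_iff_norm, norm_smul, norm_inv, norm_norm,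
        inv_mul_cancel₀ (norm_ne_zero_iff.mpr h)]⟩
  else 0

/-- The surface gradient `∇_* f = (I - x xᵀ) ∇ f`. -/
def surfGrad (f : S2 → ℝ) (x : S2) : E3 :=
  gradient (radialExt f) (x : E3)
    - inner ℝ (x : E3) (gradient (radialExt f) (x : E3)) • (x : E3)

/-- The surface curl `L_* f = x × ∇ f`. -/
def surfCurl (f : S2 → ℝ) (x : S2) : E3 :=
  cross (x : E3) (gradient (radialExt f) (x : E3))

/-! ### Scalar and vector spherical harmonics -/

/-- The Legendre polynomial of degree `ℓ` (Rodrigues' formula), normalised by `P_ℓ(1) = 1`. -/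
def legendreP (ℓ : ℕ) (t : ℝ) : ℝ :=
  ((2 : ℝ) ^ ℓ * (ℓ.factorial : ℝ))⁻¹ *
    (Polynomial.derivative^[ℓ] ((Polynomial.X ^ 2 - 1 : Polynomial ℝ) ^ ℓ)).eval t

/-- The space of spherical harmonics of degree `ℓ`: restrictions to the sphere of
homogeneous harmonic polynomials of degree `ℓ`. -/
def sphericalHarmonics (ℓ : ℕ) : Submodule ℝ (S2 → ℝ) where
  carrier := {f | ∃ p : MvPolynomial (Fin 3) ℝ, p.IsHomogeneous ℓ ∧
    ∑ i, MvPolynomial.pderiv i (MvPolynomial.pderiv i p) = 0 ∧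
    ∀ x : S2, f x = MvPolynomial.eval (fun i => (x : E3) i) p}
  zero_mem' := ⟨0, MvPolynomial.isHomogeneous_zero _ _ _, by simp, by simp⟩
  add_mem' := by
    rintro f g ⟨p, hp, hp', hpe⟩ ⟨q, hq, hq', hqe⟩
    refine ⟨p + q, hp.add hq, ?_, fun x => by simp [hpe, hqe]⟩
    simp only [map_add, Finset.sum_add_distrib, hp', hq', add_zero]
  smul_mem' := by
    rintro c f ⟨p, hp, hp', hpe⟩
    refine ⟨c • p, ?_, ?_, fun x => by simp [hpe]⟩
    · exact (MvPolynomial.homogeneousSubmodule (Fin 3) ℝ ℓ).smul_mem c hp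
    · simp only [Derivation.map_smul, ← Finset.smul_sum, hp', smul_zero]

/-- `Y ℓ k`, `k = 1, …, 2ℓ+1`, is for every degree `ℓ` an `L₂`-orthonormal basis of the space of
real spherical harmonics of degree `ℓ`. -/
structure IsSphericalHarmonicBasis (Y : (ℓ : ℕ) → Fin (2 * ℓ + 1) → S2 → ℝ) : Prop where
  span_eq : ∀ ℓ, Submodule.span ℝ (Set.range (Y ℓ)) = sphericalHarmonics ℓ
  orthonormal : ∀ ℓ j k, ∫ x, Y ℓ j x * Y ℓ k x ∂sphereMeasure = if j = k then 1 else 0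

/-- The divergence-free vector spherical harmonic `y_{ℓ,k} = L_* Y_{ℓ,k} / √(ℓ(ℓ+1))`. -/
def vshY (Y : (ℓ : ℕ) → Fin (2 * ℓ + 1) → S2 → ℝ) (ℓ : ℕ) (k : Fin (2 * ℓ + 1)) (x : S2) : E3 :=
  (Real.sqrt ((ℓ : ℝ) * ((ℓ : ℝ) + 1)))⁻¹ • surfCurl (Y ℓ k) x

/-- The curl-free vector spherical harmonic `z_{ℓ,k} = ∇_* Y_{ℓ,k} / √(ℓ(ℓ+1))`. -/
def vshZ (Y : (ℓ : ℕ) → Fin (2 * ℓ + 1) → S2 → ℝ) (ℓ : ℕ) (k : Fin (2 * ℓ + 1)) (x : S2) : E3 :=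
  (Real.sqrt ((ℓ : ℝ) * ((ℓ : ℝ) + 1)))⁻¹ • surfGrad (Y ℓ k) x

/-! ### Square integrable tangential fields and the Helmholtz–Hodge projections -/

/-- The Hilbert space `𝐋₂(𝕊²)` of square integrable tangential vector fields. -/
def TangentL2 : Submodule ℝ (Lp E3 2 sphereMeasure) where
  carrier := {f | ∀ᵐ x : S2 ∂sphereMeasure, inner ℝ (x : E3) (f x) = 0}
  zero_mem' := by
    filter_upwards [Lp.coeFn_zero E3 2 sphereMeasure] with x hx
    rw [hx]; simp
  add_mem' := by
    intro f g hf hg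
    simp only [Set.mem_ofPred_eq] at hf hg ⊢
    filter_upwards [hf, hg, Lp.coeFn_add f g] with x h1 h2 h3
    rw [h3, Pi.add_apply, inner_add_right, h1, h2, add_zero]
  smul_mem' := by
    intro c f hf
    simp only [Set.mem_ofPred_eq] at hf ⊢
    filter_upwards [hf, Lp.coeFn_smul c f] with x h1 h2
    rw [h2, Pi.smul_apply, inner_smul_right, h1, mul_zero]

theorem isClosed_TangentL2 : IsClosed (TangentL2 : Set (Lp E3 2 sphereMeasure)) := by
  rw [← isSeqClosed_iff_isClosed]
  intro u f hu hlim
  obtain ⟨ns, -, hns⟩ := (tendstoInMeasure_of_tendsto_Lp hlim).exists_seq_tendsto_ae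
  have h : ∀ n, ∀ᵐ x : S2 ∂sphereMeasure, inner ℝ (x : E3) (u (ns n) x) = 0 := fun n => hu (ns n)
  change ∀ᵐ x : S2 ∂sphereMeasure, inner ℝ (x : E3) (f x) = 0
  filter_upwards [hns, ae_all_iff.mpr h] with x h1 h2
  refine tendsto_nhds_unique (tendsto_const_nhds.inner h1) ?_
  simp [h2]

instance : CompleteSpace TangentL2 := isClosed_TangentL2.completeSpace_coe

/-- The class `u` of square integrable fields contains the vector field `f`. -/
def Represents (u : TangentL2) (f : S2 → E3) : Prop :=
  ((u : Lp E3 2 sphereMeasure) : S2 → E3) =ᵐ[sphereMeasure] f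

/-- The subspace of (weakly) divergence-free fields: `∫ f · ∇_* g = 0` for all smooth `g`. -/
def divFree : Submodule ℝ TangentL2 :=
  (Submodule.span ℝ {u : TangentL2 | ∃ g : E3 → ℝ, ContDiff ℝ ∞ g ∧
    Represents u (surfGrad fun x => g x)})ᗮ

/-- The subspace of (weakly) curl-free fields: `∫ f · L_* g = 0` for all smooth `g`. -/
def curlFree : Submodule ℝ TangentL2 :=
  (Submodule.span ℝ {u : TangentL2 | ∃ g : E3 → ℝ, ContDiff ℝ ∞ g ∧
    Represents u (surfCurl fun x => g x)})ᗮ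

instance : CompleteSpace divFree := Submodule.instOrthogonalCompleteSpace _
instance : CompleteSpace curlFree := Submodule.instOrthogonalCompleteSpace _

/-- The orthogonal projection onto the divergence-free fields. -/
def projDiv : TangentL2 →L[ℝ] TangentL2 := divFree.starProjection

/-- The orthogonal projection onto the curl-free fields. -/
def projCurl : TangentL2 →L[ℝ] TangentL2 := curlFree.starProjection

/-! ### Kernels -/

/-- The scaled zonal kernel `ψ_ρ(x · y) = C φ(ρ⁻¹ ‖x - y‖)` as a function of `t = x · y`,
where `‖x - y‖ = √(2 - 2t)`. -/
def scaledKernel (φ : ℝ → ℝ) (C ρ : ℝ) (t : ℝ) : ℝ :=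
  C * φ (ρ⁻¹ * Real.sqrt (2 - 2 * t))

/-- The Fourier–Legendre coefficient, i.e. the number such that
`ψ(x · y) = ∑_ℓ ψ̂(ℓ) (2ℓ+1)/(4π) P_ℓ(x · y)`. -/
def legendreCoeff (ψ : ℝ → ℝ) (ℓ : ℕ) : ℝ :=
  2 * Real.pi * ∫ t in (-1 : ℝ)..1, ψ t * legendreP ℓ t

/-- The auxiliary function `κ`, extended by its limits to the end points of `[-1, 1]`. -/
def kappa (ψ : ℝ → ℝ) : ℝ → ℝ :=
  extendFrom (Set.Ioo (-1) 1) fun t =>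
    (4 * Real.pi * (1 - t ^ 2))⁻¹ * ∫ s in (-1 : ℝ)..t, (1 - 4 * Real.pi * ψ s)

/-- The outer product `x yᵀ`. -/
def outer (x y : E3) : Matrix (Fin 3) (Fin 3) ℝ := Matrix.vecMulVec x.ofLp y.ofLp

def matQ (x y : E3) : Matrix (Fin 3) (Fin 3) ℝ := -outer (cross x y) (cross x y)

def matR (x y : E3) : Matrix (Fin 3) (Fin 3) ℝ := inner ℝ x y • 1 - outer y x

def matV (x y : E3) : Matrix (Fin 3) (Fin 3) ℝ :=
  outer (y - inner ℝ x y • x) (x - inner ℝ x y • y)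

def matW (x y : E3) : Matrix (Fin 3) (Fin 3) ℝ := (1 - outer x x) * (1 - outer y y)

/-- The divergence-free kernel `κ'(x·y) Q + κ(x·y) R`. The matrix `Q` vanishes for `y = ±x`,
so that no value of `κ'` at `±1` enters. -/
def kernelDiv (ψ : ℝ → ℝ) (x y : S2) : Matrix (Fin 3) (Fin 3) ℝ :=
  deriv (kappa ψ) (inner ℝ (x : E3) (y : E3)) • matQ x y
    + kappa ψ (inner ℝ (x : E3) (y : E3)) • matR x y

/-- The curl-free kernel `κ'(x·y) V + κ(x·y) W`. The matrix `V` vanishes for `y = ±x`. -/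
def kernelCurl (ψ : ℝ → ℝ) (x y : S2) : Matrix (Fin 3) (Fin 3) ℝ :=
  deriv (kappa ψ) (inner ℝ (x : E3) (y : E3)) • matV x y
    + kappa ψ (inner ℝ (x : E3) (y : E3)) • matW x y

/-- The combined kernel `Ψ = Ψ^div + Ψ^curl`. -/
def kernelSum (ψ : ℝ → ℝ) (x y : S2) : Matrix (Fin 3) (Fin 3) ℝ :=
  kernelDiv ψ x y + kernelCurl ψ x y

/-- The integrand `y ↦ K(x, y) f(y)` of a convolution. -/
def convIntegrand (K : S2 → S2 → Matrix (Fin 3) (Fin 3) ℝ) (f : S2 → E3) (x y : S2) : E3 :=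
  WithLp.toLp 2 (K x y *ᵥ (f y).ofLp)

/-- The convolution `(K * f)(x) = ∫ K(x, y) f(y) dμ(y)`. -/
def conv (K : S2 → S2 → Matrix (Fin 3) (Fin 3) ℝ) (f : S2 → E3) (x : S2) : E3 :=
  ∫ y, convIntegrand K f x y ∂sphereMeasure

/-! ### Fourier–Legendre multipliers -/

/-- `T` is the Fourier–Legendre multiplier with factors `a` (divergence-free part) and
`b` (curl-free part): `T y_{ℓ,k} = a_{ℓ,k} y_{ℓ,k}` and `T z_{ℓ,k} = b_{ℓ,k} z_{ℓ,k}`,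
the vector spherical harmonics being tangential `L₂` fields. -/
def IsFourierLegendreMultiplier (Y : (ℓ : ℕ) → Fin (2 * ℓ + 1) → S2 → ℝ)
    (T : TangentL2 →L[ℝ] TangentL2) (a b : (ℓ : ℕ) → Fin (2 * ℓ + 1) → ℝ) : Prop :=
  ∀ ℓ, 1 ≤ ℓ → ∀ k,
    (∃ u : TangentL2, Represents u (vshY Y ℓ k) ∧ T u = a ℓ k • u) ∧
    (∃ u : TangentL2, Represents u (vshZ Y ℓ k) ∧ T u = b ℓ k • u)

/-- A Fourier–Legendre multiplier is simple if its factors do not depend on the order `k`. -/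
def IsSimpleFourierLegendreMultiplier (Y : (ℓ : ℕ) → Fin (2 * ℓ + 1) → S2 → ℝ)
    (T : TangentL2 →L[ℝ] TangentL2) (a b : ℕ → ℝ) : Prop :=
  IsFourierLegendreMultiplier Y T (fun ℓ _ => a ℓ) (fun ℓ _ => b ℓ)

end

open MeasureTheory Filter Topology
open scoped Matrix ENNReal ContDiff

noncomputable section

/-! Write `t = x·y`. With `κ` replaced by `G'`, `G` a polynomial, the curl-free kernel is `∇_{*x}
∇_{*y}ᵀ G(x·y)`, so convolution with it sends a tangential `f` to the surface gradient of the
potential `x ↦ ∫ ⟨∇_* G(x·y), f(y)⟩ dμ(y)`. For surface curls `f` this potential is zero. For `f =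
∇_* p`, with `p` harmonic of degree `ℓ`, Green's formula turns it into `ℓ(ℓ+1) ∫ G(x·y) p(y) dμ(y)`,
a multiple of `p(x)` by Funk–Hecke. An integration by parts on `[-1,1]` identifies the factor, for
`ℓ ≥ 1`, as the Legendre coefficient of `1/(4π) - legOp G`.

The general kernel is a limit of these. The function `κ` satisfies `((1-t²)κ)' = 1/(4π) - ψ`, just
as `((1-t²)G')' = legOp G`. Every polynomial is a constant minus some `legOp G`, so Weierstrass and
the normalisation of `ψ` make `1/(4π) - legOp G` uniformly close to `ψ` (`exists_legendreClose`).
Then `G'` is close to `κ` and `(1-t²)G''` to `(1-t²)κ'`; since the matrix multiplying `κ'` has size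
at most `1-t²`, the kernels are uniformly close off the null set `y = ±x`
(`LegendreClose.kernelClose`). Boundedness, symmetry, range and eigenvalues all pass to the limit.

Integration by parts on the sphere is the infinitesimal rotation invariance of `μ`. Funk–Hecke is a
uniqueness statement: `G ↦ ∫ G(a·y) p(y) dμ(y)` and `G ↦ ∫ G P_ℓ` both annihilate `legOp G + ℓ(ℓ+1)
G`, which determines a functional up to a scalar (`eq_zero_of_legOp_annihilates`), and the scalar is
read off from the densities `(1+t)^n` concentrating at `t = 1`.

The divergence-free kernel is the curl-free one conjugated by the quarter turn `J u = x × u`, so its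
operator is `D = -J K J`, with `K` the curl-free operator. Both are symmetric; the range of `K`
consists of curl-free fields and is orthogonal to the divergence-free ones, and conversely for `D`.
This alone yields the statements on projections, without completeness of the vector spherical
harmonics. -/

open Polynomial in
/-- The Legendre operator, the derivative of `1 - X²` times the derivative of `G`. -/
def legOp (G : Polynomial ℝ) : Polynomial ℝ :=
  derivative ((1 - X ^ 2) * derivative G)

/-! ### Legendre's operator and functionals on polynomials -/

section Legendre

open Polynomial

theorem legOp_add (F G : ℝ[X]) : legOp (F + G) = legOp F + legOp G := by
  simp [legOp, mul_add]

theorem legOp_C_mul (c : ℝ) (G : ℝ[X]) : legOp (C c * G) = C c * legOp G := by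
  simp only [legOp, derivative_mul, derivative_C, zero_mul, zero_add]; ring_nf

theorem legOp_eq (G : ℝ[X]) :
    legOp G = (1 - X ^ 2) * derivative (derivative G) - 2 * X * derivative G := by
  simp only [legOp, derivative_mul, derivative_sub, derivative_one, derivative_X_pow]
  simp [map_ofNat]
  ring

theorem legOp_one : legOp 1 = 0 := by simp [legOp]

theorem legOp_X : legOp X = -2 * X := by
  rw [legOp_eq]; simp

theorem legOp_X_pow (n : ℕ) :
    legOp (X ^ (n + 2)) = C (((n : ℝ) + 2) * (n + 1)) * X ^ n
      - C (((n : ℝ) + 2) * (n + 3)) * X ^ (n + 2) := by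
  rw [legOp_eq]
  simp only [derivative_X_pow, derivative_mul, map_mul, map_add, map_natCast,
    derivative_natCast, zero_mul, zero_add]
  simp [map_ofNat]
  ring

/-- Every polynomial is a constant minus a value of the Legendre operator. -/
theorem exists_eq_C_sub_legOp (p : ℝ[X]) : ∃ (c : ℝ) (G : ℝ[X]), p = C c - legOp G := by
  have hX : ∀ n : ℕ, ∃ (c : ℝ) (G : ℝ[X]), (X ^ n : ℝ[X]) = C c - legOp G := by
    intro n
    induction n using Nat.strong_induction_on with
    | _ n ih =>
      match n with
      | 0 => exact ⟨1, 0, by simp [legOp]⟩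
      | 1 =>
        refine ⟨0, C (1 / 2) * X, ?_⟩
        rw [legOp_C_mul, legOp_X]
        have : (C (1 / 2 : ℝ) * 2 : ℝ[X]) = 1 := by
          rw [← C_ofNat, ← C_mul]; norm_num
        rw [C_0]
        linear_combination (-X) * this
      | n + 2 =>
        obtain ⟨c, G, h⟩ := ih n (by omega)
        have h1 := legOp_X_pow n
        set a : ℝ := ((n : ℝ) + 2) * (n + 1)
        set b : ℝ := ((n : ℝ) + 2) * (n + 3) with hb
        have hb0 : b ≠ 0 := by positivity
        -- This is `legOp X^(n+2) = a X^n - b X^(n+2)` solved for the top power, with `X^n = c -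
        -- legOp G` inserted.
        refine ⟨b⁻¹ * a * c, C b⁻¹ * X ^ (n + 2) + C (b⁻¹ * a) * G, ?_⟩
        rw [legOp_add, legOp_C_mul, legOp_C_mul, h1]
        have hbb : (C b⁻¹ * C b : ℝ[X]) = 1 := by rw [← C_mul, inv_mul_cancel₀ hb0, C_1]
        simp only [C_mul]
        linear_combination (C b⁻¹ * C a) * h - X ^ (n + 2) * hbb
  induction p using Polynomial.induction_on' with
  | add p q hp hq =>
    obtain ⟨c, G, h⟩ := hp
    obtain ⟨d, H, h'⟩ := hq
    exact ⟨c + d, G + H, by rw [h, h', legOp_add, C_add]; ring⟩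
  | monomial n a =>
    obtain ⟨c, G, h⟩ := hX n
    refine ⟨a * c, C a * G, ?_⟩
    rw [← C_mul_X_pow_eq_monomial, h, legOp_C_mul, C_mul]; ring

/-- A linear functional annihilating `legOp G + ℓ(ℓ+1) G` is determined by its value
at `X ^ ℓ`. -/
theorem eq_zero_of_legOp_annihilates {ℓ : ℕ} (F : ℝ[X] →ₗ[ℝ] ℝ)
    (hF : ∀ G, F (legOp G) + (ℓ : ℝ) * (ℓ + 1) * F G = 0) (h0 : F (X ^ ℓ) = 0) : F = 0 := by
  have hX : ∀ n : ℕ, F (X ^ n) = 0 := by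
    intro n
    induction n using Nat.strong_induction_on with
    | _ n ih =>
      by_cases hn : n = ℓ
      · rw [hn, h0]
      -- The coefficient of `X^n` in `legOp X^n + ℓ(ℓ+1) X^n` vanishes only for `n = ℓ`; otherwise
      -- `F (X^n)` is determined by the power two degrees lower.
      have hfac : (ℓ : ℝ) * (ℓ + 1) - n * (n + 1) ≠ 0 := by
        have h1 : (ℓ : ℝ) * (ℓ + 1) - n * (n + 1) = (ℓ - n) * (ℓ + n + 1) := by ring
        rw [h1]
        refine mul_ne_zero (sub_ne_zero.mpr fun h => hn ?_) (by positivity)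
        exact_mod_cast h.symm
      have h := hF (X ^ n)
      rcases n with _ | _ | n
      · rw [pow_zero, legOp_one, map_zero, zero_add] at h
        rw [pow_zero]
        exact (mul_eq_zero.mp h).resolve_left (by simpa using hfac)
      · rw [zero_add] at h hfac ⊢
        rw [pow_one, legOp_X] at h
        have h2 : (-2 * X : ℝ[X]) = (-2 : ℝ) • X := by
          rw [smul_eq_C_mul, C_neg, C_ofNat]
        rw [h2, map_smul, smul_eq_mul] at h
        rw [pow_one]
        refine (mul_eq_zero.mp (?_ : ((ℓ : ℝ) * (ℓ + 1) - (1 : ℕ) * ((1 : ℕ) + 1)) * F X = 0)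
          ).resolve_left hfac
        push_cast; linarith
      · rw [show n + 1 + 1 = n + 2 from rfl] at h hfac ⊢
        rw [legOp_X_pow, ← smul_eq_C_mul, ← smul_eq_C_mul, map_sub, map_smul, map_smul,
          ih n (by omega)] at h
        refine (mul_eq_zero.mp (?_ : ((ℓ : ℝ) * (ℓ + 1) - (n + 2 : ℕ) * ((n + 2 : ℕ) + 1)) *
          F (X ^ (n + 2)) = 0)).resolve_left hfac
        push_cast
        simp only [smul_eq_mul] at h
        linear_combination h
  refine LinearMap.ext fun G => ?_
  induction G using Polynomial.induction_on' with
  | add p q hp hq => rw [map_add, hp, hq, map_add]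
  | monomial n a =>
    rw [← C_mul_X_pow_eq_monomial, ← smul_eq_C_mul, map_smul, hX, smul_zero, LinearMap.zero_apply]

/-- The Legendre polynomial as a polynomial. -/
def legendrePoly (ℓ : ℕ) : ℝ[X] :=
  C ((2 : ℝ) ^ ℓ * (ℓ.factorial : ℝ))⁻¹ * derivative^[ℓ] ((X ^ 2 - 1) ^ ℓ)

theorem legendreP_eq (ℓ : ℕ) (t : ℝ) : legendreP ℓ t = (legendrePoly ℓ).eval t := by
  simp [legendreP, legendrePoly]

/-- This is `(X²-1) w' = 2ℓ X w` for `w = (X²-1)^ℓ`, differentiated `n+1` times. The case `n = ℓ` is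
Legendre's equation for the Rodrigues polynomial. -/
theorem iterate_derivative_rodrigues (ℓ n : ℕ) :
    (X ^ 2 - 1) * derivative^[n + 2] ((X ^ 2 - 1 : ℝ[X]) ^ ℓ)
      + C (2 * ((n : ℝ) + 1 - ℓ)) * X * derivative^[n + 1] ((X ^ 2 - 1 : ℝ[X]) ^ ℓ)
      + C (((n : ℝ) + 1) * (n - 2 * ℓ)) * derivative^[n] ((X ^ 2 - 1 : ℝ[X]) ^ ℓ) = 0 := by
  have hd : derivative (X ^ 2 - 1 : ℝ[X]) = 2 * X := by
    rw [derivative_sub, derivative_X_pow, derivative_one]; simp [map_ofNat]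
  induction n with
  | zero =>
    have h1 : (X ^ 2 - 1) * derivative ((X ^ 2 - 1 : ℝ[X]) ^ ℓ)
        - 2 * C (ℓ : ℝ) * X * (X ^ 2 - 1) ^ ℓ = 0 := by
      rw [derivative_pow, hd]
      rcases ℓ with _ | ℓ
      · simp
      · simp only [Nat.add_sub_cancel, pow_succ]; push_cast; simp; ring
    have h2 := congrArg derivative h1
    simp only [derivative_sub, derivative_mul, hd, derivative_zero, derivative_ofNat,
      derivative_C, derivative_X] at h2
    simp only [zero_add, Function.iterate_succ, Function.iterate_zero, Function.comp, id]
    rw [show (C (2 * (((0 : ℕ) : ℝ) + 1 - ℓ)) : ℝ[X]) = 2 * (1 - C (ℓ : ℝ)) by simp [map_ofNat],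
      show (C ((((0 : ℕ) : ℝ) + 1) * ((0 : ℕ) - 2 * ℓ)) : ℝ[X]) = - (2 * C (ℓ : ℝ)) by simp [map_ofNat]]
    linear_combination h2
  | succ n ih =>
    have h2 := congrArg derivative ih
    simp only [derivative_add, derivative_mul, hd, derivative_zero, derivative_C,
      derivative_X, ← Function.iterate_succ_apply' (⇑derivative)] at h2
    rw [show (C (2 * (((n + 1 : ℕ) : ℝ) + 1 - ℓ)) : ℝ[X]) = C (2 * ((n : ℝ) + 1 - ℓ)) + 2 by
        rw [← C_ofNat, ← C_add]; congr 1; push_cast; ring,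
      show (C ((((n + 1 : ℕ) : ℝ) + 1) * ((n + 1 : ℕ) - 2 * ℓ)) : ℝ[X])
          = C (2 * ((n : ℝ) + 1 - ℓ)) + C (((n : ℝ) + 1) * (n - 2 * ℓ)) by
        rw [← C_add]; congr 1; push_cast; ring]
    linear_combination h2

/-- The Legendre differential equation. -/
theorem legOp_legendrePoly (ℓ : ℕ) :
    legOp (legendrePoly ℓ) = - (C ((ℓ : ℝ) * (ℓ + 1)) * legendrePoly ℓ) := by
  have h := iterate_derivative_rodrigues ℓ ℓ
  rw [legendrePoly, legOp_C_mul, legOp_eq, ← Function.iterate_succ_apply' (⇑derivative),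
    ← Function.iterate_succ_apply' (⇑derivative)]
  rw [show (2 * ((ℓ : ℝ) + 1 - ℓ)) = 2 by ring,
    show (((ℓ : ℝ) + 1) * (ℓ - 2 * ℓ)) = - (ℓ * (ℓ + 1)) by ring, C_neg, C_ofNat] at h
  linear_combination (-C ((2 : ℝ) ^ ℓ * (ℓ.factorial : ℝ))⁻¹) * h

/-- From `(X²-1)^ℓ = (X-1)^ℓ (X+1)^ℓ`, the `ℓ`-th derivative at the root `1` is `ℓ!` times the
cofactor `2^ℓ`. -/
theorem legendrePoly_eval_one (ℓ : ℕ) : (legendrePoly ℓ).eval 1 = 1 := by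
  have h := aeval_iterate_derivative_self (A := ℝ) ((X ^ 2 - 1 : ℝ[X]) ^ ℓ) ℓ (1 : ℝ)
    (p' := (X + 1) ^ ℓ) (by rw [← mul_pow]; simp; ring)
  rw [legendrePoly, eval_mul, eval_C, ← coe_aeval_eq_eval, h]
  have : ((2 : ℝ) ^ ℓ * (ℓ.factorial : ℝ)) ≠ 0 := by positivity
  simp only [eval_pow, eval_add, eval_X, eval_one, nsmul_eq_mul]
  field_simp
  norm_num

/-- Integration of a polynomial over `[-1, 1]` as a linear functional. -/
def polyInt : ℝ[X] →ₗ[ℝ] ℝ where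
  toFun G := ∫ t in (-1 : ℝ)..1, G.eval t
  map_add' F G := by
    simp only [eval_add]
    exact intervalIntegral.integral_add (F.continuous.intervalIntegrable _ _)
      (G.continuous.intervalIntegrable _ _)
  map_smul' c G := by simp

theorem polyInt_apply (G : ℝ[X]) : polyInt G = ∫ t in (-1 : ℝ)..1, G.eval t := rfl

theorem polyInt_derivative (G : ℝ[X]) : polyInt (derivative G) = G.eval 1 - G.eval (-1) :=
  intervalIntegral.integral_eq_sub_of_hasDerivAt (fun t _ => G.hasDerivAt t)
    ((derivative G).continuous.intervalIntegrable _ _)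

theorem polyInt_mono {F G : ℝ[X]} (h : ∀ t ∈ Set.Icc (-1 : ℝ) 1, F.eval t ≤ G.eval t) :
    polyInt F ≤ polyInt G :=
  intervalIntegral.integral_mono_on (by norm_num) (F.continuous.intervalIntegrable _ _)
    (G.continuous.intervalIntegrable _ _) h

/-- The functional `G ↦ ∫ G P_ℓ`. -/
def legInt (ℓ : ℕ) : ℝ[X] →ₗ[ℝ] ℝ := polyInt ∘ₗ LinearMap.mulRight ℝ (legendrePoly ℓ)

theorem legInt_apply (ℓ : ℕ) (G : ℝ[X]) : legInt ℓ G = polyInt (G * legendrePoly ℓ) := rfl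

/-- Lagrange's identity: for `P = P_ℓ`, `legOp G * P - legOp P * G` is the derivative of `(1-X²)(G'P
- P'G)`, which vanishes at `±1`. -/
theorem legInt_legOp (ℓ : ℕ) (G : ℝ[X]) :
    legInt ℓ (legOp G) + (ℓ : ℝ) * (ℓ + 1) * legInt ℓ G = 0 := by
  have h := polyInt_derivative
    ((1 - X ^ 2) * derivative G * legendrePoly ℓ - (1 - X ^ 2) * derivative (legendrePoly ℓ) * G)
  have h2 : derivative ((1 - X ^ 2) * derivative G * legendrePoly ℓ
        - (1 - X ^ 2) * derivative (legendrePoly ℓ) * G)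
      = legOp G * legendrePoly ℓ + ((ℓ : ℝ) * (ℓ + 1)) • (G * legendrePoly ℓ) := by
    have h3 := legOp_legendrePoly ℓ
    rw [derivative_sub, derivative_mul (g := legendrePoly ℓ), derivative_mul (g := G)]
    change legOp G * _ + _ - (legOp (legendrePoly ℓ) * _ + _) = _
    rw [h3, smul_eq_C_mul]
    ring
  rw [h2, map_add, map_smul] at h
  rw [legInt_apply, legInt_apply]
  simpa using h

theorem polyInt_legOp (G : ℝ[X]) : polyInt (legOp G) = 0 := by
  rw [legOp, polyInt_derivative]; simp

theorem legInt_one {ℓ : ℕ} (hℓ : 1 ≤ ℓ) : legInt ℓ 1 = 0 := by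
  have h := legInt_legOp ℓ 1
  rw [legOp_one, map_zero, zero_add] at h
  exact (mul_eq_zero.mp h).resolve_left (by positivity)

/-- The functional `F` is asymptotically `a` times integration over `[-1, 1]` for
nonnegative densities concentrating at `1`. -/
def ConcentratesAt (F : ℝ[X] →ₗ[ℝ] ℝ) (a : ℝ) : Prop :=
  ∀ ε > 0, ∃ M, ∀ G : ℝ[X], (∀ t ∈ Set.Icc (-1 : ℝ) 1, 0 ≤ G.eval t) →
    |F G - a * polyInt G| ≤ ε * polyInt G + M * polyInt ((1 - X) * G)

theorem polyInt_one_add_X_pow (n : ℕ) :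
    polyInt ((1 + X) ^ n) = 2 ^ (n + 1) / (n + 1) := by
  have h := polyInt_derivative ((1 + X) ^ (n + 1))
  rw [derivative_pow] at h
  simp only [derivative_add, derivative_one, derivative_X, zero_add, mul_one,
    Nat.add_sub_cancel] at h
  rw [← smul_eq_C_mul, map_smul] at h
  simp at h
  rw [eq_div_iff (by positivity), mul_comm, h]; norm_num

theorem polyInt_one_sub_X_mul (n : ℕ) :
    polyInt ((1 - X) * (1 + X) ^ n) = 2 / (n + 2) * polyInt ((1 + X) ^ n) := by
  have h : ((1 - X) * (1 + X) ^ n : ℝ[X]) = (2 : ℝ) • (1 + X) ^ n - (1 + X) ^ (n + 1) := by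
    rw [smul_eq_C_mul, C_ofNat]; ring
  rw [h, map_sub, map_smul, polyInt_one_add_X_pow, polyInt_one_add_X_pow]
  push_cast
  rw [smul_eq_mul, pow_succ 2 (n + 1)]
  field_simp
  ring

/-- Under the density proportional to `(1+t)^n` the mean of `1-t` is `2/(n+2)`, so the term with `M`
disappears in the limit. -/
theorem ConcentratesAt.tendsto {F : ℝ[X] →ₗ[ℝ] ℝ} {a : ℝ} (h : ConcentratesAt F a) :
    Tendsto (fun n : ℕ => F ((1 + X) ^ n) / polyInt ((1 + X) ^ n)) atTop (𝓝 a) := by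
  rw [Metric.tendsto_atTop]
  intro ε hε
  obtain ⟨M, hM⟩ := h (ε / 2) (by positivity)
  have hlim : Tendsto (fun n : ℕ => M * (2 / ((n : ℝ) + 2))) atTop (𝓝 (M * 0)) :=
    (Tendsto.const_div_atTop (tendsto_natCast_atTop_atTop.atTop_add tendsto_const_nhds) _).const_mul _
  rw [mul_zero] at hlim
  obtain ⟨N, hN⟩ := eventually_atTop.mp (hlim.eventually (gt_mem_nhds (half_pos hε)))
  refine ⟨N, fun n hn => ?_⟩
  have h1 := hM ((1 + X) ^ n) (fun t ht => by
    have : 0 ≤ 1 + t := by linarith [ht.1]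
    simpa using pow_nonneg this n)
  have hpos : 0 < polyInt ((1 + X) ^ n) := by rw [polyInt_one_add_X_pow]; positivity
  rw [polyInt_one_sub_X_mul] at h1
  rw [Real.dist_eq, show F ((1 + X) ^ n) / polyInt ((1 + X) ^ n) - a
    = (F ((1 + X) ^ n) - a * polyInt ((1 + X) ^ n)) / polyInt ((1 + X) ^ n) by field_simp,
    abs_div, abs_of_pos hpos, div_lt_iff₀ hpos]
  have h2 := hN n hn
  nlinarith [mul_lt_mul_of_pos_right h2 hpos]

/-- Two functionals annihilating `legOp G + ℓ(ℓ+1) G` are proportional. -/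
theorem eq_smul_of_concentratesAt {ℓ : ℕ} {F H : ℝ[X] →ₗ[ℝ] ℝ} {a : ℝ}
    (hF : ∀ G, F (legOp G) + (ℓ : ℝ) * (ℓ + 1) * F G = 0)
    (hH : ∀ G, H (legOp G) + (ℓ : ℝ) * (ℓ + 1) * H G = 0)
    (hFa : ConcentratesAt F a) (hH1 : ConcentratesAt H 1) : F = a • H := by
  -- This combination has the annihilation property and vanishes at `X^ℓ` by construction.
  have key : H (X ^ ℓ) • F - F (X ^ ℓ) • H = 0 := by
    refine eq_zero_of_legOp_annihilates (ℓ := ℓ) _ (fun G => ?_) ?_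
    · simp only [LinearMap.sub_apply, LinearMap.smul_apply, smul_eq_mul]
      linear_combination H (X ^ ℓ) * hF G - F (X ^ ℓ) * hH G
    · simp; ring
  have heq : ∀ G, H (X ^ ℓ) * F G = F (X ^ ℓ) * H G := fun G => by
    have := congrArg (fun Φ => Φ G) key
    simp at this
    linarith
  have h1 : H (X ^ ℓ) * a = F (X ^ ℓ) * 1 :=
    tendsto_nhds_unique (hFa.tendsto.const_mul _)
      ((hH1.tendsto.const_mul (F (X ^ ℓ))).congr fun n => by
        rw [← mul_div_assoc, ← mul_div_assoc, heq])
  -- The limit identity `h1` says precisely that `F - a H` vanishes at `X^ℓ`; `H (X^ℓ) ≠ 0` need not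
  -- be known.
  rw [← sub_eq_zero]
  refine eq_zero_of_legOp_annihilates (ℓ := ℓ) _ (fun G => ?_) ?_
  · simp only [LinearMap.sub_apply, LinearMap.smul_apply, smul_eq_mul]
    linear_combination hF G - a * hH G
  · simp; linarith

/-- Since `P_ℓ(1) = 1`, `P_ℓ - 1` is `X - 1` times a polynomial bounded on `[-1,1]`; that bound
serves as `M` for every `ε`. -/
theorem legInt_concentratesAt (ℓ : ℕ) : ConcentratesAt (legInt ℓ) 1 := by
  intro ε hε
  obtain ⟨Q, hQ⟩ : (X - C 1 : ℝ[X]) ∣ legendrePoly ℓ - 1 :=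
    dvd_iff_isRoot.mpr (by simp [IsRoot, legendrePoly_eval_one])
  obtain ⟨M, hM⟩ := isCompact_Icc.exists_bound_of_continuousOn
    (Q.continuous.continuousOn (s := Set.Icc (-1 : ℝ) 1))
  refine ⟨M, fun G hG => ?_⟩
  have h1 : legInt ℓ G - 1 * polyInt G = - polyInt (Q * ((1 - X) * G)) := by
    rw [one_mul, legInt_apply, ← map_sub, ← map_neg]; congr 1
    rw [C_1] at hQ
    linear_combination G * hQ
  have h2 : ∀ t ∈ Set.Icc (-1 : ℝ) 1, 0 ≤ ((1 - X) * G : ℝ[X]).eval t := fun t ht => by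
    rw [eval_mul]; exact mul_nonneg (by simp [ht.2]) (hG t ht)
  have h3 : |polyInt (Q * ((1 - X) * G))| ≤ M * polyInt ((1 - X) * G) := by
    have e : M * polyInt ((1 - X) * G) = polyInt (M • ((1 - X) * G)) := by simp
    rw [abs_le, e, ← map_neg]
    refine ⟨polyInt_mono fun t ht => ?_, polyInt_mono fun t ht => ?_⟩
    · have := neg_le_of_abs_le (hM t ht)
      rw [eval_neg, eval_smul, eval_mul (p := Q), smul_eq_mul, ← neg_mul]
      exact mul_le_mul_of_nonneg_right this (h2 t ht)
    · have := le_of_abs_le (hM t ht)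
      rw [eval_smul, eval_mul (p := Q), smul_eq_mul]
      exact mul_le_mul_of_nonneg_right this (h2 t ht)
  have h4 : 0 ≤ ε * polyInt G := by
    refine mul_nonneg hε.le ?_
    rw [← map_zero polyInt]
    exact polyInt_mono fun t ht => by simpa using hG t ht
  rw [h1, abs_neg]
  linarith

end Legendre

/-! ### Rotation invariance of the surface measure -/

section RotationInvariance

theorem norm_S2 (x : S2) : ‖(x : E3)‖ = 1 := mem_sphere_zero_iff_norm.mp x.2

theorem inner_self_S2 (x : S2) : inner ℝ (x : E3) (x : E3) = 1 := by
  rw [real_inner_self_eq_norm_sq, norm_S2, one_pow]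

/-- The action of a linear isometry on the sphere. -/
def sphereMap (A : E3 ≃ₗᵢ[ℝ] E3) (x : S2) : S2 :=
  ⟨A x, by rw [mem_sphere_zero_iff_norm, A.norm_map, norm_S2]⟩

theorem continuous_sphereMap (A : E3 ≃ₗᵢ[ℝ] E3) : Continuous (sphereMap A) :=
  (A.continuous.comp continuous_subtype_val).subtype_mk _

-- The surface measure of a set is a constant multiple of the volume of the cone over it; a linear
-- isometry maps cones to cones and preserves volume.
open scoped Pointwise in
theorem measurePreserving_sphereMap (A : E3 ≃ₗᵢ[ℝ] E3) :
    MeasurePreserving (sphereMap A) sphereMeasure sphereMeasure := by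
  refine ⟨(continuous_sphereMap A).measurable, Measure.ext fun s hs => ?_⟩
  rw [Measure.map_apply (continuous_sphereMap A).measurable hs, Measure.toSphere_apply' _ hs,
    Measure.toSphere_apply' _ ((continuous_sphereMap A).measurable hs)]
  congr 1
  have hv := A.measurePreserving.measure_preimage_equiv (f := A.toHomeomorph.toMeasurableEquiv)
    (Set.Ioo (0 : ℝ) 1 • ((↑) '' s : Set E3))
  rw [← hv]
  congr 1
  ext y
  simp only [Set.mem_smul, Set.mem_image, Set.mem_preimage, Subtype.exists]
  constructor
  · rintro ⟨r, hr, _, ⟨x, hx, hxs, rfl⟩, rfl⟩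
    exact ⟨r, hr, A x, ⟨A x, (sphereMap A ⟨x, hx⟩).2, hxs, rfl⟩, (A.map_smul r x).symm⟩
  · rintro ⟨r, hr, _, ⟨x, hx, hxs, rfl⟩, h⟩
    have h' : A y = r • x := h.symm
    refine ⟨r, hr, A.symm x, ⟨A.symm x, ?_, ?_, rfl⟩, ?_⟩
    · rw [mem_sphere_zero_iff_norm, A.symm.norm_map]; exact mem_sphere_zero_iff_norm.mp hx
    · have : sphereMap A (sphereMap A.symm ⟨x, hx⟩) = ⟨x, hx⟩ := Subtype.ext (A.apply_symm_apply x)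
      exact this ▸ hxs
    · rw [← A.symm.map_smul, ← h', A.symm_apply_apply]

theorem integral_comp_sphereMap (A : E3 ≃ₗᵢ[ℝ] E3) {f : S2 → ℝ} (hf : Continuous f) :
    ∫ y, f (sphereMap A y) ∂sphereMeasure = ∫ y, f y ∂sphereMeasure := by
  conv_rhs => rw [← (measurePreserving_sphereMap A).map_eq]
  exact (integral_map (continuous_sphereMap A).aemeasurable hf.aestronglyMeasurable).symm

theorem integrable_sphere {F : Type*} [NormedAddCommGroup F] {f : S2 → F}
    (hf : Continuous f) : Integrable f sphereMeasure :=
  hf.integrable_of_hasCompactSupport (HasCompactSupport.of_compactSpace f)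

/-- The standard basis vectors. -/
abbrev basisVec (i : Fin 3) : E3 := EuclideanSpace.single i (1 : ℝ)

/-- The rotation by the angle `θ` about the `i`-th coordinate axis, as a linear map. -/
def axisRotLin (i : Fin 3) (θ : ℝ) : E3 →ₗ[ℝ] E3 where
  toFun y := y i • basisVec i
    + (Real.cos θ * y (i + 1) - Real.sin θ * y (i + 2)) • basisVec (i + 1)
    + (Real.sin θ * y (i + 1) + Real.cos θ * y (i + 2)) • basisVec (i + 2)
  map_add' x y := by simp only [PiLp.add_apply]; module
  map_smul' c y := by simp only [PiLp.smul_apply, smul_eq_mul, RingHom.id_apply]; module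

/-- The rotation by the angle `θ` about the `i`-th coordinate axis. -/
def axisRot (i : Fin 3) (θ : ℝ) : E3 ≃ₗᵢ[ℝ] E3 :=
  LinearIsometry.toLinearIsometryEquiv
    { axisRotLin i θ with
      norm_map' := fun y => by
        rw [← sq_eq_sq₀ (norm_nonneg _) (norm_nonneg _), EuclideanSpace.real_norm_sq_eq,
          EuclideanSpace.real_norm_sq_eq, Fin.sum_univ_three, Fin.sum_univ_three]
        have h := Real.sin_sq_add_cos_sq θ
        fin_cases i <;> simp [axisRotLin] <;>
        [linear_combination (y 1 ^ 2 + y 2 ^ 2) * h;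
          linear_combination (y 0 ^ 2 + y 2 ^ 2) * h;
          linear_combination (y 0 ^ 2 + y 1 ^ 2) * h] } rfl

theorem axisRot_apply (i : Fin 3) (θ : ℝ) (y : E3) : axisRot i θ y = y i • basisVec i
    + (Real.cos θ * y (i + 1) - Real.sin θ * y (i + 2)) • basisVec (i + 1)
    + (Real.sin θ * y (i + 1) + Real.cos θ * y (i + 2)) • basisVec (i + 2) := rfl

theorem axisRot_zero (i : Fin 3) (y : E3) : axisRot i 0 y = y := by
  rw [axisRot_apply]
  ext m
  fin_cases i <;> fin_cases m <;> simp

/-- The derivative along the infinitesimal rotation about the `i`-th axis. -/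
def rotDeriv (i : Fin 3) (h : E3 → ℝ) (y : E3) : ℝ :=
  -- This is the `i`-th component of `y × ∇h`: addition in `Fin 3` is cyclic.
  y (i + 1) * fderiv ℝ h y (basisVec (i + 2)) - y (i + 2) * fderiv ℝ h y (basisVec (i + 1))

theorem continuous_rotDeriv (i : Fin 3) {h : E3 → ℝ} (hh : ContDiff ℝ 1 h) :
    Continuous (rotDeriv i h) := by
  have h1 := hh.continuous_fderiv one_ne_zero
  unfold rotDeriv
  fun_prop

theorem hasDerivAt_comp_axisRot (i : Fin 3) {h : E3 → ℝ} (hh : ContDiff ℝ 1 h) (y : E3) (θ : ℝ) :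
    HasDerivAt (fun θ => h (axisRot i θ y)) (rotDeriv i h (axisRot i θ y)) θ := by
  have h1 : HasDerivAt (fun θ => axisRot i θ y)
      ((-Real.sin θ * y (i + 1) - Real.cos θ * y (i + 2)) • basisVec (i + 1)
        + (Real.cos θ * y (i + 1) + -Real.sin θ * y (i + 2)) • basisVec (i + 2)) θ := by
    simp only [axisRot_apply]
    have hs := Real.hasDerivAt_sin θ
    have hc := Real.hasDerivAt_cos θ
    exact ((((hc.mul_const (y (i + 1))).sub (hs.mul_const (y (i + 2)))).smul_const
      (basisVec (i + 1))).const_add (y i • basisVec i)).add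
      (((hs.mul_const (y (i + 1))).add (hc.mul_const (y (i + 2)))).smul_const (basisVec (i + 2)))
  have h2 := ((hh.differentiable one_ne_zero).differentiableAt (x := axisRot i θ y)).hasFDerivAt
    |>.comp_hasDerivAt θ h1
  convert! h2 using 1
  rw [map_add, map_smul, map_smul, rotDeriv]
  have e1 : (axisRot i θ y) (i + 1) = Real.cos θ * y (i + 1) - Real.sin θ * y (i + 2) := by
    rw [axisRot_apply]; fin_cases i <;> simp
  have e2 : (axisRot i θ y) (i + 2) = Real.sin θ * y (i + 1) + Real.cos θ * y (i + 2) := by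
    rw [axisRot_apply]; fin_cases i <;> simp
  rw [e1, e2]
  simp only [smul_eq_mul]
  ring

/-- Infinitesimal rotation invariance of the surface measure. -/
theorem integral_rotDeriv (i : Fin 3) {h : E3 → ℝ} (hh : ContDiff ℝ 1 h) :
    ∫ y : S2, rotDeriv i h y ∂sphereMeasure = 0 := by
  have hc := hh.continuous
  have hcont := continuous_rotDeriv i hh
  obtain ⟨M, hM⟩ := (isCompact_sphere (0 : E3) 1).exists_bound_of_continuousOn hcont.continuousOn
  -- The function `θ ↦ ∫ h(R_θ y) dμ(y)` is constant; differentiating under the integral at `θ = 0`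
  -- gives the claim.
  have key := hasDerivAt_integral_of_dominated_loc_of_deriv_le (μ := sphereMeasure)
    (F := fun θ (y : S2) => h (axisRot i θ y)) (F' := fun θ y => rotDeriv i h (axisRot i θ y))
    (x₀ := (0 : ℝ)) (s := Set.univ) (bound := fun _ => M) univ_mem
    (Eventually.of_forall fun θ =>
      (hc.comp ((axisRot i θ).continuous.comp continuous_subtype_val)).aestronglyMeasurable)
    (integrable_sphere (hc.comp ((axisRot i 0).continuous.comp continuous_subtype_val)))
    (hcont.comp ((axisRot i 0).continuous.comp continuous_subtype_val)).aestronglyMeasurable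
    (Eventually.of_forall fun y θ _ => hM _ (sphereMap (axisRot i θ) y).2)
    (integrable_const M)
    (Eventually.of_forall fun y θ _ => hasDerivAt_comp_axisRot i hh y θ)
  have hconst : (fun θ => ∫ y : S2, h (axisRot i θ y) ∂sphereMeasure)
      = fun _ => ∫ y : S2, h y ∂sphereMeasure := by
    ext θ
    exact integral_comp_sphereMap (axisRot i θ) (hc.comp continuous_subtype_val)
  have h2 := key.2
  rw [hconst] at h2
  simpa only [axisRot_zero] using h2.unique (hasDerivAt_const _ _)

theorem sphereMeasure_real_univ : sphereMeasure.real Set.univ = 4 * Real.pi := by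
  rw [Measure.toSphere_real_apply_univ, measureReal_def, EuclideanSpace.volume_ball_fin_three]
  simp
  have := ENNReal.toReal_ofReal (show (0 : ℝ) ≤ Real.pi * 4 / 3 by positivity)
  linarith

end RotationInvariance

/-! ### Integration by parts and the Laplace–Beltrami operator on polynomials -/

section PolynomialFields

open MvPolynomial

/-- A polynomial in three variables as a function on `E3`. -/
def pe (p : MvPolynomial (Fin 3) ℝ) (y : E3) : ℝ := eval (fun i => y i) p

@[simp] theorem pe_add (p q : MvPolynomial (Fin 3) ℝ) (y : E3) : pe (p + q) y = pe p y + pe q y :=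
  map_add _ _ _
@[simp] theorem pe_sub (p q : MvPolynomial (Fin 3) ℝ) (y : E3) : pe (p - q) y = pe p y - pe q y :=
  map_sub _ _ _
@[simp] theorem pe_neg (p : MvPolynomial (Fin 3) ℝ) (y : E3) : pe (-p) y = -pe p y :=
  map_neg _ _
@[simp] theorem pe_mul (p q : MvPolynomial (Fin 3) ℝ) (y : E3) : pe (p * q) y = pe p y * pe q y :=
  map_mul _ _ _
@[simp] theorem pe_C (c : ℝ) (y : E3) : pe (C c) y = c := eval_C _
@[simp] theorem pe_X (i : Fin 3) (y : E3) : pe (X i) y = y i := eval_X _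
@[simp] theorem pe_zero (y : E3) : pe 0 y = 0 := map_zero _
@[simp] theorem pe_one (y : E3) : pe 1 y = 1 := map_one _
@[simp] theorem pe_sum {ι : Type*} (s : Finset ι) (p : ι → MvPolynomial (Fin 3) ℝ) (y : E3) :
    pe (∑ i ∈ s, p i) y = ∑ i ∈ s, pe (p i) y := map_sum _ _ _

theorem contDiff_pe (p : MvPolynomial (Fin 3) ℝ) : ContDiff ℝ ∞ (pe p) := by
  induction p using MvPolynomial.induction_on with
  | C a => simpa [funext (pe_C a)] using contDiff_const
  | add p q hp hq => simpa [funext (pe_add p q)] using hp.add hq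
  | mul_X p i hp =>
    have : ContDiff ℝ ∞ (fun y : E3 => y i) := contDiff_piLp_apply 2
    simpa [funext (pe_mul p (X i))] using hp.mul this

theorem continuous_pe (p : MvPolynomial (Fin 3) ℝ) : Continuous (pe p) := (contDiff_pe p).continuous

theorem differentiable_pe (p : MvPolynomial (Fin 3) ℝ) : Differentiable ℝ (pe p) :=
  (contDiff_pe p).differentiable (by simp)

/-- The gradient field of a polynomial. -/
def pgrad (p : MvPolynomial (Fin 3) ℝ) (y : E3) : E3 :=
  WithLp.toLp 2 fun i => pe (pderiv i p) y

theorem fderiv_pe (p : MvPolynomial (Fin 3) ℝ) (y v : E3) :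
    fderiv ℝ (pe p) y v = ∑ i, v i * pe (pderiv i p) y := by
  induction p using MvPolynomial.induction_on with
  | C a =>
    rw [show pe (C a : MvPolynomial (Fin 3) ℝ) = fun _ => a from funext (pe_C a)]
    simp
  | add p q hp hq =>
    rw [show pe (p + q) = pe p + pe q from funext (pe_add p q),
      fderiv_add (differentiable_pe p y) (differentiable_pe q y), add_apply, hp, hq,
      ← Finset.sum_add_distrib]
    simp [mul_add]
  | mul_X p i hp =>
    rw [show pe (p * X i) = fun z => pe p z * (EuclideanSpace.proj i : E3 →L[ℝ] ℝ) z from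
        funext fun z => by simp,
      fderiv_fun_mul (differentiable_pe p y) (ContinuousLinearMap.differentiableAt _)]
    simp only [add_apply, smul_apply, ContinuousLinearMap.fderiv, hp, smul_eq_mul,
      Derivation.leibniz, pe_add, pe_mul, pe_X, pderiv_X, mul_add, Finset.sum_add_distrib,
      Finset.mul_sum]
    congr 1
    · rw [Finset.sum_eq_single i]
      · simp; ring
      · intro j _ hj; simp [hj.symm]
      · simp
    · exact Finset.sum_congr rfl fun j _ => by simp; ring

theorem fderiv_pe_basisVec (p : MvPolynomial (Fin 3) ℝ) (y : E3) (i : Fin 3) :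
    fderiv ℝ (pe p) y (basisVec i) = pe (pderiv i p) y := by
  rw [fderiv_pe, Finset.sum_eq_single i] <;> simp +contextual

theorem gradient_pe (p : MvPolynomial (Fin 3) ℝ) (y : E3) : gradient (pe p) y = pgrad p y := by
  refine ext_inner_right ℝ fun v => ?_
  rw [gradient, InnerProductSpace.toDual_symm_apply, fderiv_pe, PiLp.inner_apply]
  simp [pgrad]

theorem continuous_pgrad (p : MvPolynomial (Fin 3) ℝ) : Continuous (pgrad p) :=
  (PiLp.continuous_toLp 2 _).comp (continuous_pi fun _ => continuous_pe _)

/-- The infinitesimal rotation about the `i`-th axis on polynomials. -/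
def rotPoly (i : Fin 3) (p : MvPolynomial (Fin 3) ℝ) : MvPolynomial (Fin 3) ℝ :=
  X (i + 1) * pderiv (i + 2) p - X (i + 2) * pderiv (i + 1) p

theorem rotDeriv_pe (i : Fin 3) (p : MvPolynomial (Fin 3) ℝ) (y : E3) :
    rotDeriv i (pe p) y = pe (rotPoly i p) y := by
  simp [rotDeriv, rotPoly, fderiv_pe_basisVec]

theorem rotDeriv_mul (i : Fin 3) {g h : E3 → ℝ} (hg : ContDiff ℝ 1 g) (hh : ContDiff ℝ 1 h)
    (y : E3) : rotDeriv i (g * h) y = g y * rotDeriv i h y + h y * rotDeriv i g y := by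
  rw [rotDeriv, fderiv_mul (hg.differentiable one_ne_zero y) (hh.differentiable one_ne_zero y)]
  simp only [add_apply, smul_apply, smul_eq_mul, rotDeriv]
  ring

/-- Integration by parts: infinitesimal rotations obey the Leibniz rule and their images integrate
to zero. -/
theorem integral_mul_rotPoly (i : Fin 3) {g : E3 → ℝ} (hg : ContDiff ℝ 1 g)
    (p : MvPolynomial (Fin 3) ℝ) :
    ∫ y : S2, g y * pe (rotPoly i p) y ∂sphereMeasure
      = -∫ y : S2, pe p y * rotDeriv i g y ∂sphereMeasure := by
  have hp : ContDiff ℝ 1 (pe p) := (contDiff_pe p).of_le (by norm_cast)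
  have h := integral_rotDeriv i (hg.mul hp)
  have e : ∀ y : S2, rotDeriv i (fun y => g y * pe p y) (y : E3)
      = g y * pe (rotPoly i p) y + pe p y * rotDeriv i g y := fun y => by
    rw [← rotDeriv_pe]; exact rotDeriv_mul i hg hp y
  rw [integral_congr_ae (Eventually.of_forall e), integral_add] at h
  · linarith
  · exact integrable_sphere (by
      have := hg.continuous; have := continuous_pe (rotPoly i p); fun_prop)
  · exact integrable_sphere (by
      have := continuous_rotDeriv i hg; have := continuous_pe p; fun_prop)

theorem integral_mul_rotPoly' (i : Fin 3) (p q : MvPolynomial (Fin 3) ℝ) :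
    ∫ y : S2, pe p y * pe (rotPoly i q) y ∂sphereMeasure
      = -∫ y : S2, pe q y * pe (rotPoly i p) y ∂sphereMeasure := by
  rw [integral_mul_rotPoly i ((contDiff_pe p).of_le (by norm_cast))]
  simp only [rotDeriv_pe]

/-- The Laplace–Beltrami operator, on polynomials. -/
def sphLap (p : MvPolynomial (Fin 3) ℝ) : MvPolynomial (Fin 3) ℝ :=
  ∑ i, rotPoly i (rotPoly i p)

/-- The commutator of two derivations is a derivation, and this one vanishes on the variables. -/
theorem pderiv_comm (i j : Fin 3) (p : MvPolynomial (Fin 3) ℝ) :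
    pderiv i (pderiv j p) = pderiv j (pderiv i p) := by
  have h : ⁅(pderiv i : Derivation ℝ (MvPolynomial (Fin 3) ℝ) (MvPolynomial (Fin 3) ℝ)),
      (pderiv j : Derivation ℝ (MvPolynomial (Fin 3) ℝ) (MvPolynomial (Fin 3) ℝ))⁆ = 0 := by
    refine derivation_ext fun k => ?_
    simp [Derivation.commutator_apply, pderiv_X, Pi.single_apply, apply_ite]
  have h2 := congrArg (fun D => D p) h
  rw [Derivation.commutator_apply] at h2
  exact sub_eq_zero.mp h2

/-- With the Euler operator `E = ∑ X_i ∂_i`, the squared infinitesimal rotations add up to `|x|² Δ -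
E² - E`. -/
theorem sphLap_eq (p : MvPolynomial (Fin 3) ℝ) :
    sphLap p = (∑ i, X i ^ 2) * ∑ i, pderiv i (pderiv i p)
      - ∑ i, X i * pderiv i (∑ j, X j * pderiv j p) - ∑ i, X i * pderiv i p := by
  simp only [sphLap, rotPoly, Fin.sum_univ_three, Derivation.leibniz, map_sub, map_add, pderiv_X,
    smul_eq_mul]
  have h1 := pderiv_comm 1 0 p
  have h2 := pderiv_comm 2 0 p
  have h3 := pderiv_comm 2 1 p
  simp [show (2 : Fin 3) + 1 = 0 from rfl, show (2 : Fin 3) + 2 = 1 from rfl,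
    show (1 : Fin 3) + 2 = 0 from rfl, show (1 : Fin 3) + 1 = 2 from rfl, h1, h2, h3]
  ring

/-- Only `-E² - E` survives on a harmonic polynomial, and `E` acts as `ℓ` by homogeneity. -/
theorem sphLap_harmonic {ℓ : ℕ} {p : MvPolynomial (Fin 3) ℝ} (hp : p.IsHomogeneous ℓ)
    (hΔ : ∑ i, pderiv i (pderiv i p) = 0) :
    sphLap p = -(C ((ℓ : ℝ) * (ℓ + 1)) * p) := by
  have e := hp.sum_X_mul_pderiv
  rw [sphLap_eq, hΔ, e]
  have : ∀ i, pderiv i (ℓ • p) = ℓ • pderiv i p := fun i => map_nsmul _ _ _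
  simp only [this, mul_smul_comm, ← Finset.smul_sum, e]
  simp only [nsmul_eq_mul, map_mul, map_add, map_natCast, map_one]
  ring

theorem integral_rotPoly_mul_rotPoly (p q : MvPolynomial (Fin 3) ℝ) :
    ∫ y : S2, ∑ i, pe (rotPoly i p) y * pe (rotPoly i q) y ∂sphereMeasure
      = -∫ y : S2, pe p y * pe (sphLap q) y ∂sphereMeasure := by
  have hc : ∀ a b : MvPolynomial (Fin 3) ℝ,
      Integrable (fun y : S2 => pe a y * pe b y) sphereMeasure := fun a b =>
    integrable_sphere (by have := continuous_pe a; have := continuous_pe b; fun_prop)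
  rw [integral_finsetSum _ fun i _ => hc _ _]
  simp only [sphLap, pe_sum, Finset.mul_sum]
  rw [integral_finsetSum _ fun i _ => hc _ _, ← Finset.sum_neg_distrib]
  refine Finset.sum_congr rfl fun i _ => ?_
  rw [integral_mul_rotPoly' i p, neg_neg]
  simp only [mul_comm]

theorem integral_mul_sphLap_comm (p q : MvPolynomial (Fin 3) ℝ) :
    ∫ y : S2, pe p y * pe (sphLap q) y ∂sphereMeasure
      = ∫ y : S2, pe q y * pe (sphLap p) y ∂sphereMeasure := by
  have h1 := integral_rotPoly_mul_rotPoly p q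
  have h2 := integral_rotPoly_mul_rotPoly q p
  simp only [mul_comm (pe (rotPoly _ q) _)] at h2
  linarith

end PolynomialFields

/-! ### Zonal functions, the hat-box theorem and the Funk–Hecke formula -/

section FunkHecke

open Polynomial

theorem inner_E3 (a y : E3) : inner ℝ a y = a 0 * y 0 + a 1 * y 1 + a 2 * y 2 := by
  simp [PiLp.inner_apply, Fin.sum_univ_three]; ring

/-- The zonal polynomial `y ↦ G (a · y)`. -/
def zonal (G : ℝ[X]) (a : E3) : MvPolynomial (Fin 3) ℝ :=
  aeval (∑ i, MvPolynomial.C (a i) * MvPolynomial.X i) G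

theorem pe_zonal (G : ℝ[X]) (a y : E3) : pe (zonal G a) y = G.eval (inner ℝ a y) := by
  rw [pe, zonal, ← MvPolynomial.coe_aeval_eq_eval, RingHom.coe_coe, ← Polynomial.aeval_algHom_apply,
    Polynomial.coe_aeval_eq_eval]
  congr 1
  simp [inner_E3, Fin.sum_univ_three]

theorem pderiv_zonal (i : Fin 3) (G : ℝ[X]) (a : E3) :
    MvPolynomial.pderiv i (zonal G a) = MvPolynomial.C (a i) * zonal (derivative G) a := by
  rw [zonal, Derivation.map_aeval, zonal, smul_eq_mul, mul_comm]
  congr 1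
  rw [map_sum, Finset.sum_eq_single i]
  · simp
  · intro j _ hj; simp [MvPolynomial.pderiv_X_of_ne hj]
  · simp

/-- The link between sphere and interval. For `t = a·y` and unit vectors, `Δ` gives `G''`, `E` gives
`t G'` and `E²` gives `t G' + t² G''`; their combination is Legendre's operator. -/
theorem pe_sphLap_zonal (G : ℝ[X]) (a y : S2) :
    pe (sphLap (zonal G a)) y = (legOp G).eval (inner ℝ (a : E3) (y : E3)) := by
  rw [sphLap_eq, legOp_eq]
  simp only [Derivation.leibniz, pderiv_zonal, MvPolynomial.pderiv_X,
    MvPolynomial.derivation_C, Fin.sum_univ_three, smul_eq_mul, pe_sub, pe_add, pe_mul, pe_C, pe_X, pe_zonal, pow_two,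
    map_add]
  have h1 := inner_self_S2 a
  have h2 := inner_self_S2 y
  have h3 := inner_E3 (a : E3) (y : E3)
  rw [inner_E3] at h1 h2
  generalize inner ℝ (a : E3) (y : E3) = t at *
  simp
  generalize (derivative G).eval t = g1
  generalize (derivative (derivative G)).eval t = g2
  rw [h3]
  linear_combination g2 * h1 + ((a : E3) 0 * (a : E3) 0 + (a : E3) 1 * (a : E3) 1 +
    (a : E3) 2 * (a : E3) 2) * g2 * h2

theorem continuous_zonal (G : ℝ[X]) (a : E3) :
    Continuous fun y : S2 => G.eval (inner ℝ a (y : E3)) := by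
  have := G.continuous
  fun_prop

/-- The functional `G ↦ ∫ G(a · y) p(y) dμ(y)`. -/
def zonalInt (p : MvPolynomial (Fin 3) ℝ) (a : E3) : ℝ[X] →ₗ[ℝ] ℝ where
  toFun G := ∫ y : S2, G.eval (inner ℝ a (y : E3)) * pe p y ∂sphereMeasure
  map_add' F G := by
    have hp := continuous_pe p
    have hF := continuous_zonal F a
    have hG := continuous_zonal G a
    rw [← integral_add (integrable_sphere (by fun_prop)) (integrable_sphere (by fun_prop))]
    simp only [eval_add, add_mul]
  map_smul' c G := by
    simp only [eval_smul, smul_eq_mul, RingHom.id_apply, mul_assoc]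
    exact integral_const_mul _ _

theorem zonalInt_apply (p : MvPolynomial (Fin 3) ℝ) (a : E3) (G : ℝ[X]) :
    zonalInt p a G = ∫ y : S2, G.eval (inner ℝ a (y : E3)) * pe p y ∂sphereMeasure := rfl

/-- The Laplace–Beltrami operator is symmetric, so it can be moved from the zonal factor to its
eigenfunction `p`. -/
theorem zonalInt_legOp {ℓ : ℕ} {p : MvPolynomial (Fin 3) ℝ} (hp : p.IsHomogeneous ℓ)
    (hΔ : ∑ i, MvPolynomial.pderiv i (MvPolynomial.pderiv i p) = 0) (a : S2) (G : ℝ[X]) :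
    zonalInt p a (legOp G) + (ℓ : ℝ) * (ℓ + 1) * zonalInt p a G = 0 := by
  have h := integral_mul_sphLap_comm (zonal G a) p
  rw [sphLap_harmonic hp hΔ] at h
  simp only [pe_neg, pe_mul, pe_C, pe_zonal, pe_sphLap_zonal] at h
  rw [zonalInt_apply, zonalInt_apply]
  rw [show (∫ y : S2, (legOp G).eval (inner ℝ (a : E3) (y : E3)) * pe p y ∂sphereMeasure)
    = ∫ y : S2, pe p y * (legOp G).eval (inner ℝ (a : E3) (y : E3)) ∂sphereMeasure by
      simp only [mul_comm], ← h, ← integral_const_mul, ← integral_add]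
  · refine (integral_congr_ae (Eventually.of_forall fun y => ?_)).trans (integral_zero _ _)
    ring
  all_goals
    have hp := continuous_pe p
    have hG := continuous_zonal G a
    exact integrable_sphere (by fun_prop)

/-- The Archimedean hat-box theorem for polynomials. -/
theorem integral_zonal (a : S2) (G : ℝ[X]) :
    ∫ y : S2, G.eval (inner ℝ (a : E3) (y : E3)) ∂sphereMeasure = 2 * Real.pi * polyInt G := by
  have key : zonalInt 1 a - (2 * Real.pi) • polyInt = 0 := by
    -- For `ℓ = 0` only the values at `X^0 = 1` remain to be compared: the total mass `4π` against
    -- `2π · 2`.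
    refine eq_zero_of_legOp_annihilates (ℓ := 0) _ (fun G => ?_) ?_
    · have := zonalInt_legOp (MvPolynomial.isHomogeneous_one (Fin 3) ℝ) (by simp) a G
      simp only [LinearMap.sub_apply, LinearMap.smul_apply, polyInt_legOp]
      simpa using this
    · simp only [LinearMap.sub_apply, LinearMap.smul_apply, zonalInt_apply, polyInt_apply]
      simp [-Measure.toSphere_real_apply_univ, sphereMeasure_real_univ]
      ring
  have h := congrArg (fun Φ => Φ G) key
  simp only [LinearMap.sub_apply, LinearMap.smul_apply, zonalInt_apply, pe_one, mul_one,
    LinearMap.zero_apply, smul_eq_mul] at h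
  linarith

theorem norm_sub_sq_S2 (x y : S2) :
    ‖(x : E3) - y‖ ^ 2 = 2 - 2 * inner ℝ (x : E3) (y : E3) := by
  rw [norm_sub_sq_real, norm_S2, norm_S2]; ring

theorem inner_mem_Icc (x y : S2) : inner ℝ (x : E3) (y : E3) ∈ Set.Icc (-1 : ℝ) 1 := by
  have h := abs_real_inner_le_norm (x : E3) (y : E3)
  rw [norm_S2, norm_S2, one_mul] at h
  exact abs_le.mp h

/-- Near `a` continuity gives `ε`; at distance at least `δ` one has `1 - a·y ≥ δ²/2`, so a multiple
of it dominates the global bound `B`. -/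
theorem exists_abs_sub_le {f : S2 → ℝ} (hf : Continuous f) (a : S2) {ε : ℝ} (hε : 0 < ε) :
    ∃ M, ∀ y : S2, |f y - f a| ≤ ε + M * (1 - inner ℝ (a : E3) (y : E3)) := by
  obtain ⟨B, hB⟩ := isCompact_univ.exists_bound_of_continuousOn
    ((hf.sub (continuous_const : Continuous fun _ : S2 => f a)).continuousOn (s := Set.univ))
  obtain ⟨δ, hδ, h⟩ := Metric.continuous_iff.mp hf a ε hε
  have hB0 : 0 ≤ B := (norm_nonneg _).trans (hB a trivial)
  refine ⟨2 * B / δ ^ 2, fun y => ?_⟩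
  have h1 := (inner_mem_Icc a y).2
  by_cases hy : dist y a < δ
  · have := h y hy
    rw [Real.dist_eq] at this
    have : 0 ≤ 2 * B / δ ^ 2 * (1 - inner ℝ (a : E3) (y : E3)) :=
      mul_nonneg (by positivity) (by linarith)
    linarith
  · have h2 : δ ^ 2 ≤ 2 * (1 - inner ℝ (a : E3) (y : E3)) := by
      rw [mul_sub, mul_one, ← norm_sub_sq_S2, ← dist_eq_norm, dist_comm]
      exact pow_le_pow_left₀ hδ.le (not_lt.mp hy) 2
    have h3 : B ≤ 2 * B / δ ^ 2 * (1 - inner ℝ (a : E3) (y : E3)) := by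
      rw [div_mul_eq_mul_div, le_div_iff₀ (by positivity)]
      nlinarith [mul_le_mul_of_nonneg_left h2 hB0]
    have : |f y - f a| ≤ B := hB y trivial
    linarith

/-- The hat-box theorem rewrites both integrals over `[-1,1]` as integrals over the sphere, where
the estimate of `p(y) - p(a)` by `ε + M(1 - a·y)` applies pointwise. -/
theorem zonalInt_concentratesAt (p : MvPolynomial (Fin 3) ℝ) (a : S2) :
    ConcentratesAt (zonalInt p a) (2 * Real.pi * pe p a) := by
  intro ε hε
  obtain ⟨M, hM⟩ := exists_abs_sub_le ((continuous_pe p).comp continuous_subtype_val) a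
    (show 0 < ε / (2 * Real.pi) by positivity)
  refine ⟨2 * Real.pi * M, fun G hG => ?_⟩
  have hp := continuous_pe p
  have hGc := continuous_zonal G a
  have hG1 := continuous_zonal ((1 - X) * G) a
  have e1 : zonalInt p a G - 2 * Real.pi * pe p a * polyInt G
      = ∫ y : S2, G.eval (inner ℝ (a : E3) (y : E3)) * (pe p y - pe p a) ∂sphereMeasure := by
    rw [mul_right_comm, ← integral_zonal a G, zonalInt_apply, ← integral_mul_const,
      ← integral_sub (integrable_sphere (by fun_prop)) (integrable_sphere (by fun_prop))]
    simp only [mul_sub]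
  have e2 : ε * polyInt G + 2 * Real.pi * M * polyInt ((1 - X) * G)
      = ∫ y : S2, (ε / (2 * Real.pi) * G.eval (inner ℝ (a : E3) (y : E3))
        + M * ((1 - X) * G).eval (inner ℝ (a : E3) (y : E3))) ∂sphereMeasure := by
    rw [integral_add (integrable_sphere (by fun_prop)) (integrable_sphere (by fun_prop)),
      integral_const_mul, integral_const_mul, integral_zonal, integral_zonal]
    field_simp
  rw [e1, e2, ← Real.norm_eq_abs]
  refine norm_integral_le_of_norm_le (integrable_sphere (by fun_prop))
    (Eventually.of_forall fun y => ?_)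
  have h0 := hG _ (inner_mem_Icc a y)
  rw [norm_mul, Real.norm_of_nonneg h0, Real.norm_eq_abs, eval_mul, eval_sub, eval_one, eval_X]
  have := mul_le_mul_of_nonneg_left (hM y) h0
  simp only [Function.comp] at this
  linarith

/-- The Funk–Hecke formula for polynomials. -/
theorem funkHecke {ℓ : ℕ} {p : MvPolynomial (Fin 3) ℝ} (hp : p.IsHomogeneous ℓ)
    (hΔ : ∑ i, MvPolynomial.pderiv i (MvPolynomial.pderiv i p) = 0) (a : S2) (G : ℝ[X]) :
    ∫ y : S2, G.eval (inner ℝ (a : E3) (y : E3)) * pe p y ∂sphereMeasure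
      = 2 * Real.pi * legInt ℓ G * pe p a := by
  have h := congrArg (fun Φ => Φ G) (eq_smul_of_concentratesAt (zonalInt_legOp hp hΔ a)
    (legInt_legOp ℓ) (zonalInt_concentratesAt p a) (legInt_concentratesAt ℓ))
  simp only [LinearMap.smul_apply, smul_eq_mul, zonalInt_apply] at h
  rw [h]; ring

/-- The zonal functions `((1 + a·y)/2)^n` dominate the indicator of `{a}`, and their integrals
`4π/(n+1)` tend to zero. -/
theorem sphereMeasure_singleton (a : S2) : sphereMeasure {a} = 0 := by
  have hlim : Tendsto (fun n : ℕ => 2 * Real.pi * (2 / ((n : ℝ) + 1))) atTop (𝓝 (2 * Real.pi * 0)) :=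
    (Tendsto.const_div_atTop (tendsto_natCast_atTop_atTop.atTop_add tendsto_const_nhds) _).const_mul _
  rw [mul_zero] at hlim
  have hle : ∀ n : ℕ, sphereMeasure.real {a} ≤ 2 * Real.pi * (2 / ((n : ℝ) + 1)) := fun n => by
    have h := integral_zonal a (((1 / 2 : ℝ) ^ n) • (1 + X) ^ n)
    have h2 : 2 * Real.pi * polyInt (((1 / 2 : ℝ) ^ n) • (1 + X) ^ n)
        = 2 * Real.pi * (2 / ((n : ℝ) + 1)) := by
      rw [map_smul, polyInt_one_add_X_pow, smul_eq_mul, pow_succ 2 n, one_div, inv_pow]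
      field_simp
    rw [← h2, ← h, ← integral_indicator_one (measurableSet_singleton a)]
    refine integral_mono ((integrable_const (1 : ℝ)).indicator (measurableSet_singleton a))
      (integrable_sphere (continuous_zonal _ _)) fun y => ?_
    have h0 := (inner_mem_Icc a y).1
    by_cases hy : y = a
    · subst hy
      rw [Set.indicator_of_mem (Set.mem_singleton y), inner_self_S2]
      simp only [eval_smul, eval_pow, eval_add, eval_one, eval_X, smul_eq_mul, ← mul_pow]
      norm_num
    · rw [Set.indicator_of_notMem (show y ∉ ({a} : Set S2) from hy)]
      simp only [eval_smul, eval_pow, eval_add, eval_one, eval_X, smul_eq_mul]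
      exact mul_nonneg (by positivity) (pow_nonneg (by linarith) n)
  have h0 := ge_of_tendsto' hlim hle
  exact (measureReal_eq_zero_iff (measure_ne_top _ _)).mp (le_antisymm h0 measureReal_nonneg)

theorem ae_ne_and_ne_neg (x : S2) :
    ∀ᵐ y : S2 ∂sphereMeasure, inner ℝ (x : E3) (y : E3) ∈ Set.Ioo (-1 : ℝ) 1 := by
  have h1 : ∀ a : S2, ∀ᵐ y : S2 ∂sphereMeasure, y ≠ a := fun a => by
    rw [ae_iff]; simpa using sphereMeasure_singleton a
  filter_upwards [h1 x, h1 (-x)] with y hy hy'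
  have h := inner_mem_Icc x y
  refine ⟨lt_of_le_of_ne h.1 fun e => hy' ?_, lt_of_le_of_ne h.2 fun e => hy ?_⟩
  · have := norm_sub_sq_S2 y (-x)
    rw [show ((-x : S2) : E3) = -(x : E3) from rfl, inner_neg_right, real_inner_comm, ← e] at this
    norm_num at this
    have h2 := sub_eq_zero.mp (norm_eq_zero.mp (by simpa using this) :
      (y : E3) - ((-x : S2) : E3) = 0)
    exact Subtype.ext h2
  · have := norm_sub_sq_S2 y x
    rw [real_inner_comm, e] at this
    norm_num at this
    exact Subtype.ext (sub_eq_zero.mp this)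

end FunkHecke

/-! ### Surface gradient and surface curl as tangential operations -/

section TangentialDerivatives

/-- The tangential part of `v` at the point `x` of the sphere. -/
def tang (x v : E3) : E3 := v - inner ℝ x v • x

theorem cross_zero_coord (x y : E3) : cross x y 0 = x 1 * y 2 - x 2 * y 1 := by
  simp [cross, cross_apply]
theorem cross_one_coord (x y : E3) : cross x y 1 = x 2 * y 0 - x 0 * y 2 := by
  simp [cross, cross_apply]
theorem cross_two_coord (x y : E3) : cross x y 2 = x 0 * y 1 - x 1 * y 0 := by
  simp [cross, cross_apply]

theorem cross_add_right (x u v : E3) : cross x (u + v) = cross x u + cross x v := by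
  ext i; fin_cases i <;> simp [cross_zero_coord, cross_one_coord, cross_two_coord] <;> ring

theorem cross_smul_right (c : ℝ) (x u : E3) : cross x (c • u) = c • cross x u := by
  ext i; fin_cases i <;> simp [cross_zero_coord, cross_one_coord, cross_two_coord] <;> ring

theorem cross_eq_neg_cross (x y : E3) : cross x y = -cross y x := by
  ext i; fin_cases i <;> simp [cross_zero_coord, cross_one_coord, cross_two_coord] <;> ring

/-- Cross product with a fixed vector as a continuous linear map. -/
def crossL (x : E3) : E3 →L[ℝ] E3 :=
  LinearMap.toContinuousLinearMap
    { toFun := cross x, map_add' := cross_add_right x, map_smul' := fun c => cross_smul_right c x }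

@[simp] theorem crossL_apply (x y : E3) : crossL x y = cross x y := rfl

theorem inner_cross_self_left (x y : E3) : inner ℝ x (cross x y) = 0 := by
  rw [inner_E3, cross_zero_coord, cross_one_coord, cross_two_coord]; ring

theorem inner_cross_left (x u v : E3) : inner ℝ (cross x u) v = -inner ℝ u (cross x v) := by
  simp only [inner_E3, cross_zero_coord, cross_one_coord, cross_two_coord]; ring

/-- Together with `cross_cross_self` this says that `x ×` is the tangential projection followed by a
quarter turn of the tangent plane. -/
theorem inner_cross_cross (x : S2) (u v : E3) :
    inner ℝ (cross x u) (cross x v) = inner ℝ (tang x u) (tang x v) := by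
  have h := inner_self_S2 x
  simp only [tang, inner_sub_left, inner_sub_right, inner_smul_left, inner_smul_right, h]
  simp only [inner_E3, cross_zero_coord, cross_one_coord, cross_two_coord] at h ⊢
  simp
  linear_combination ((u 0 * v 0) + (u 1 * v 1) + (u 2 * v 2)) * h

theorem cross_cross_self (x : S2) (v : E3) : cross x (cross x v) = -tang x v := by
  have h := inner_self_S2 x
  rw [inner_E3] at h
  ext i
  fin_cases i <;>
    simp [cross_zero_coord, cross_one_coord, cross_two_coord, tang, inner_E3] <;>
    [linear_combination (-v 0) * h; linear_combination (-v 1) * h; linear_combination (-v 2) * h]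

theorem cross_tang (x v : E3) : cross x (tang x v) = cross x v := by
  ext i
  fin_cases i <;> simp [cross_zero_coord, cross_one_coord, cross_two_coord, tang] <;> ring

theorem inner_tang (x : S2) (v : E3) : inner ℝ (x : E3) (tang x v) = 0 := by
  rw [tang, inner_sub_right, inner_smul_right, inner_self_S2]; ring

theorem tang_of_inner_eq_zero {x v : E3} (h : inner ℝ x v = 0) : tang x v = v := by
  rw [tang, h, zero_smul, sub_zero]

theorem tang_add (x u v : E3) : tang x (u + v) = tang x u + tang x v := by
  simp only [tang, inner_add_right, add_smul]; abel

theorem tang_smul (c : ℝ) (x v : E3) : tang x (c • v) = c • tang x v := by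
  simp only [tang, inner_smul_right, smul_sub, mul_smul]

/-- The tangential projection as a continuous linear map. -/
def tangL (x : E3) : E3 →L[ℝ] E3 :=
  LinearMap.toContinuousLinearMap
    { toFun := tang x, map_add' := tang_add x, map_smul' := fun c => tang_smul c x }

@[simp] theorem tangL_apply (x y : E3) : tangL x y = tang x y := rfl

theorem norm_tang_le (x : S2) (v : E3) : ‖tang x v‖ ≤ ‖v‖ := by
  rw [← sq_le_sq₀ (norm_nonneg _) (norm_nonneg _), ← real_inner_self_eq_norm_sq,
    ← real_inner_self_eq_norm_sq]
  have h := inner_self_S2 x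
  have : inner ℝ (tang x v) (tang x v) = inner ℝ v v - inner ℝ (x : E3) v ^ 2 := by
    simp only [tang, inner_sub_left, inner_sub_right, inner_smul_left, inner_smul_right, h,
      real_inner_comm v (x : E3)]
    simp; ring
  nlinarith [sq_nonneg (inner ℝ (x : E3) v)]

theorem continuous_cross {X : Type*} [TopologicalSpace X] {f g : X → E3} (hf : Continuous f)
    (hg : Continuous g) : Continuous fun z => cross (f z) (g z) := by
  refine (PiLp.continuous_toLp 2 _).comp (continuous_pi fun i => ?_)
  fin_cases i <;> simp [cross_apply] <;> fun_prop

theorem continuous_tang {X : Type*} [TopologicalSpace X] {f g : X → E3} (hf : Continuous f)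
    (hg : Continuous g) : Continuous fun z => tang (f z) (g z) := by
  unfold tang; fun_prop

theorem hasFDerivAt_normalize (x : S2) :
    HasFDerivAt (fun y : E3 => ‖y‖⁻¹ • y) (tangL x) x := by
  -- Here `‖y‖⁻¹` is treated as `(‖y‖²)^(-1/2)`, a power of a smooth function that equals `1` at
  -- `x`.
  have h1 := ((hasStrictFDerivAt_norm_sq (x : E3)).rpow_const (p := -(1 / 2 : ℝ))
    (Or.inl (by rw [norm_S2]; norm_num))).hasFDerivAt.smul (hasFDerivAt_id (x : E3))
  have e : (fun y : E3 => ‖y‖⁻¹ • y) = fun y : E3 => ((‖y‖ ^ 2) ^ (-(1 / 2 : ℝ))) • id y := by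
    ext1 y
    rw [Real.rpow_neg (by positivity), ← Real.sqrt_eq_rpow, Real.sqrt_sq (norm_nonneg y), id]
  rw [e]
  convert! h1 using 1
  ext1 v
  simp [tang]
  abel

/-- Near `x` the radial extension is `g(y/‖y‖)`; the derivative of the normalisation is the
tangential projection, which is self-adjoint. -/
theorem hasGradientAt_radialExt {g : E3 → ℝ} (x : S2) (hg : DifferentiableAt ℝ g x) :
    HasGradientAt (radialExt fun y => g y) (tang x (gradient g x)) (x : E3) := by
  have hx0 : (x : E3) ≠ 0 := by
    intro h; have := norm_S2 x; rw [h, norm_zero] at this; norm_num at this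
  have h1 : HasFDerivAt (fun y : E3 => g (‖y‖⁻¹ • y)) ((fderiv ℝ g x).comp (tangL x)) x := by
    refine HasFDerivAt.comp (x : E3) (g := g) ?_ (hasFDerivAt_normalize x)
    rw [norm_S2, inv_one, one_smul]
    exact hg.hasFDerivAt
  have h2 : HasFDerivAt (radialExt fun y => g y) ((fderiv ℝ g x).comp (tangL x)) x := by
    refine h1.congr_of_eventuallyEq ?_
    filter_upwards [isOpen_ne.mem_nhds hx0] with y hy
    rw [radialExt, dif_pos hy]
  have h3 := hasFDerivAt_iff_hasGradientAt.mp h2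
  convert! h3 using 1
  refine ext_inner_right ℝ fun v => ?_
  rw [InnerProductSpace.toDual_symm_apply, ContinuousLinearMap.comp_apply, tangL_apply,
    ← InnerProductSpace.toDual_symm_apply (𝕜 := ℝ)]
  change inner ℝ (tang x (gradient g x)) v = inner ℝ (gradient g x) (tang x v)
  simp only [tang, inner_sub_left, inner_sub_right, inner_smul_left, inner_smul_right]
  simp [real_inner_comm]; ring

theorem surfGrad_eq {g : E3 → ℝ} (x : S2) (hg : DifferentiableAt ℝ g x) :
    surfGrad (fun y => g y) x = tang x (gradient g x) := by
  rw [surfGrad, (hasGradientAt_radialExt x hg).gradient, inner_tang, zero_smul, sub_zero]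

theorem surfCurl_eq {g : E3 → ℝ} (x : S2) (hg : DifferentiableAt ℝ g x) :
    surfCurl (fun y => g y) x = cross x (gradient g x) := by
  rw [surfCurl, (hasGradientAt_radialExt x hg).gradient, cross_tang]

theorem surfGrad_pe (p : MvPolynomial (Fin 3) ℝ) (x : S2) :
    surfGrad (fun y => pe p y) x = tang x (pgrad p x) := by
  rw [surfGrad_eq x (differentiable_pe p _), gradient_pe]

theorem surfCurl_pe (p : MvPolynomial (Fin 3) ℝ) (x : S2) :
    surfCurl (fun y => pe p y) x = cross x (pgrad p x) := by
  rw [surfCurl_eq x (differentiable_pe p _), gradient_pe]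

theorem surfCurl_eq_cross_surfGrad {g : E3 → ℝ} (x : S2) (hg : DifferentiableAt ℝ g x) :
    surfCurl (fun y => g y) x = cross x (surfGrad (fun y => g y) x) := by
  rw [surfGrad_eq x hg, surfCurl_eq x hg, cross_tang]

theorem inner_cross_pgrad (p q : MvPolynomial (Fin 3) ℝ) (y : E3) :
    inner ℝ (cross y (pgrad p y)) (cross y (pgrad q y))
      = ∑ i, pe (rotPoly i p) y * pe (rotPoly i q) y := by
  simp [inner_E3, cross_zero_coord, cross_one_coord, cross_two_coord, Fin.sum_univ_three, rotPoly,
    pgrad]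

/-- The Green formula on the sphere, for polynomials. -/
theorem integral_inner_tang_pgrad (p q : MvPolynomial (Fin 3) ℝ) :
    ∫ y : S2, inner ℝ (tang y (pgrad p y)) (tang y (pgrad q y)) ∂sphereMeasure
      = -∫ y : S2, pe p y * pe (sphLap q) y ∂sphereMeasure := by
  simp only [← inner_cross_cross, inner_cross_pgrad, integral_rotPoly_mul_rotPoly]

/-- This is `x · (∇ × ∇p) = 0`. -/
theorem sum_rotPoly_pderiv (p : MvPolynomial (Fin 3) ℝ) : ∑ i, rotPoly i (MvPolynomial.pderiv i p) = 0 := by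
  simp only [Fin.sum_univ_three, rotPoly, zero_add, show (1 : Fin 3) + 1 = 2 from rfl,
    show (1 : Fin 3) + 2 = 0 from rfl, show (2 : Fin 3) + 2 = 1 from rfl,
    show (2 : Fin 3) + 1 = 0 from rfl, pderiv_comm 1 0 p, pderiv_comm 2 0 p, pderiv_comm 2 1 p]
  ring

theorem gradient_coord {g : E3 → ℝ} (y : E3) (i : Fin 3) :
    (gradient g y) i = fderiv ℝ g y (basisVec i) := by
  have h : inner ℝ (gradient g y) (basisVec i) = fderiv ℝ g y (basisVec i) :=
    InnerProductSpace.toDual_symm_apply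
  rw [← h, inner_E3]
  fin_cases i <;> simp

/-- Surface gradients are orthogonal to surface curls. -/
theorem integral_inner_surfGrad_surfCurl {g : E3 → ℝ} (hg : ContDiff ℝ 1 g)
    (p : MvPolynomial (Fin 3) ℝ) :
    ∫ y : S2, inner ℝ (tang y (gradient g y)) (cross y (pgrad p y)) ∂sphereMeasure = 0 := by
  -- Permuting the triple product puts the rotations on `g`. Integration by parts then moves them to
  -- the `∂_i p`, where their sum is zero; hence `g` need only be `C¹`.
  have e : ∀ y : S2, inner ℝ (tang y (gradient g y)) (cross y (pgrad p y))
      = -∑ i, pe (MvPolynomial.pderiv i p) y * rotDeriv i g y := fun y => by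
    rw [tang, inner_sub_left, inner_smul_left, inner_cross_self_left, mul_zero, sub_zero,
      real_inner_comm, inner_cross_left, neg_inj]
    simp only [rotDeriv, ← gradient_coord]
    simp [inner_E3, cross_zero_coord, cross_one_coord, cross_two_coord, Fin.sum_univ_three, pgrad]
  have hc := fun i => continuous_rotDeriv i hg
  have hp := fun i => continuous_pe (MvPolynomial.pderiv i p)
  have hgc := hg.continuous
  have hr := fun i => continuous_pe (rotPoly i (MvPolynomial.pderiv i p))
  simp only [e]
  rw [integral_neg, integral_finsetSum _ fun i _ =>
      integrable_sphere (by have := hc i; have := hp i; fun_prop),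
    ← Finset.sum_neg_distrib, Finset.sum_congr rfl fun i _ => (integral_mul_rotPoly i hg _).symm,
    ← integral_finsetSum _ fun i _ => integrable_sphere (by have := hr i; fun_prop)]
  simp only [← Finset.mul_sum, ← pe_sum, sum_rotPoly_pderiv, pe_zero, mul_zero, integral_zero]

end TangentialDerivatives

/-! ### Polynomial potentials of zonal convolutions -/

section Potentials

open Polynomial

theorem integrable_smul_of_continuous {F : Type*} [NormedAddCommGroup F] [NormedSpace ℝ F]
    {c : S2 → ℝ} {f : S2 → F} (hc : Continuous c)
    (hf : Integrable f sphereMeasure) : Integrable (fun y => c y • f y) sphereMeasure := by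
  obtain ⟨M, hM⟩ := isCompact_univ.exists_bound_of_continuousOn (hc.continuousOn (s := Set.univ))
  exact hf.bdd_smul M hc.aestronglyMeasurable (Eventually.of_forall fun y => hM y trivial)

theorem integrable_smul_of_continuous' {F : Type*} [NormedAddCommGroup F] [NormedSpace ℝ F]
    {c : S2 → ℝ} {f : S2 → F} (hc : Integrable c sphereMeasure)
    (hf : Continuous f) : Integrable (fun y => c y • f y) sphereMeasure := by
  obtain ⟨M, hM⟩ := isCompact_univ.exists_bound_of_continuousOn (hf.continuousOn (s := Set.univ))
  exact hc.smul_bdd M hf.aestronglyMeasurable (Eventually.of_forall fun y => hM y trivial)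

theorem integrable_coord {f : S2 → E3} (hf : Integrable f sphereMeasure) (i : Fin 3) :
    Integrable (fun y => f y i) sphereMeasure :=
  (EuclideanSpace.proj i : E3 →L[ℝ] ℝ).integrable_comp hf

theorem continuous_coord (i : Fin 3) : Continuous fun y : S2 => (y : E3) i := by fun_prop

/-- Zonal potentials of integrable functions are polynomials. -/
theorem exists_zonal_potential (G : ℝ[X]) : ∀ f : S2 → ℝ, Integrable f sphereMeasure →
    ∃ P : MvPolynomial (Fin 3) ℝ,
      (∀ x, pe P x = ∫ y : S2, G.eval (inner ℝ x (y : E3)) * f y ∂sphereMeasure) ∧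
      ∀ i x, pe (MvPolynomial.pderiv i P) x
        = ∫ y : S2, (derivative G).eval (inner ℝ x (y : E3)) * ((y : E3) i * f y) ∂sphereMeasure := by
  have hint : ∀ (G : ℝ[X]) (x : E3) (f : S2 → ℝ), Integrable f sphereMeasure →
      Integrable (fun y : S2 => G.eval (inner ℝ x (y : E3)) * f y) sphereMeasure :=
    fun G x f hf => integrable_smul_of_continuous (continuous_zonal G x) hf
  have hcoord : ∀ (i : Fin 3) (f : S2 → ℝ), Integrable f sphereMeasure →
      Integrable (fun y : S2 => (y : E3) i * f y) sphereMeasure :=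
    fun i f hf => integrable_smul_of_continuous (continuous_coord i) hf
  induction G using Polynomial.induction_on with
  | C a =>
    intro f hf
    refine ⟨MvPolynomial.C (a * ∫ y, f y ∂sphereMeasure), fun x => ?_, fun i x => ?_⟩
    · simp only [eval_C, pe_C]; rw [integral_const_mul]
    · simp
  | add G H hG hH =>
    intro f hf
    obtain ⟨P, hP, hP'⟩ := hG f hf
    obtain ⟨Q, hQ, hQ'⟩ := hH f hf
    refine ⟨P + Q, fun x => ?_, fun i x => ?_⟩
    · rw [pe_add, hP, hQ, ← integral_add (hint _ _ _ hf) (hint _ _ _ hf)]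
      simp only [eval_add, add_mul]
    · rw [map_add, pe_add, hP', hQ', ← integral_add (hint _ _ _ (hcoord i f hf))
        (hint _ _ _ (hcoord i f hf))]
      simp only [derivative_add, eval_add, add_mul]
  | monomial n a ih =>
    intro f hf
    -- From `(x·y)^(n+1) = ∑ x_j y_j (x·y)^n`: the factor `y_j` is absorbed into the density, so the
    -- induction must range over all `f`.
    choose P hP hP' using fun j => ih (fun y => (y : E3) j * f y) (hcoord j f hf)
    refine ⟨∑ j, MvPolynomial.X j * P j, fun x => ?_, fun i x => ?_⟩
    · simp only [pe_sum, pe_mul, pe_X, hP]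
      simp only [← integral_const_mul]
      rw [← integral_finsetSum _ fun j _ => (hint _ _ _ (hcoord j f hf)).const_mul _]
      refine integral_congr_ae (Eventually.of_forall fun y => ?_)
      simp only [eval_mul, eval_C, eval_pow, eval_X, pow_succ, Fin.sum_univ_three]
      conv_rhs => rw [inner_E3 x]
      have := inner_E3 x (y : E3)
      rw [this]
      ring
    · have e1 : pe (MvPolynomial.pderiv i (∑ j, MvPolynomial.X j * P j)) x
          = pe (P i) x + ∑ j, x j * pe (MvPolynomial.pderiv i (P j)) x := by
        simp only [map_sum, Derivation.leibniz, smul_eq_mul, pe_sum, pe_add, pe_mul, pe_X,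
          Finset.sum_add_distrib]
        rw [add_comm, Finset.sum_eq_single i]
        · simp
        · intro j _ hj; simp [MvPolynomial.pderiv_X_of_ne hj]
        · simp
      rw [e1, hP]
      simp only [hP', ← integral_const_mul]
      rw [← integral_finsetSum _ fun j _ =>
        (hint _ _ _ (hcoord i _ (hcoord j f hf))).const_mul _, ← integral_add
        (hint _ _ _ (hcoord i f hf)) (integrable_finsetSum _ fun j _ =>
        (hint _ _ _ (hcoord i _ (hcoord j f hf))).const_mul _)]
      refine integral_congr_ae (Eventually.of_forall fun y => ?_)
      have h := inner_E3 x (y : E3)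
      have e2 : derivative (C a * X ^ (n + 1) : ℝ[X]) = C a * X ^ n + derivative (C a * X ^ n) * X := by
        rw [pow_succ, ← mul_assoc, derivative_mul, derivative_X]; ring
      rw [e2]
      simp only [eval_add, eval_mul (q := X), eval_X, Fin.sum_univ_three]
      generalize inner ℝ x (y : E3) = t at h ⊢
      generalize (derivative (C a * X ^ n : ℝ[X])).eval t = d
      generalize (C a * X ^ n : ℝ[X]).eval t = e
      rw [h]; ring

/-- The potential of a vector field. -/
theorem exists_vector_potential (q : ℝ[X]) {f : S2 → E3} (hf : Integrable f sphereMeasure) :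
    ∃ P : MvPolynomial (Fin 3) ℝ,
      (∀ x, pe P x = ∫ y : S2, q.eval (inner ℝ x (y : E3)) * inner ℝ x (f y) ∂sphereMeasure) ∧
      ∀ x, pgrad P x = ∫ y : S2, (((derivative q).eval (inner ℝ x (y : E3)) * inner ℝ x (f y)) •
        (y : E3) + q.eval (inner ℝ x (y : E3)) • f y) ∂sphereMeasure := by
  have hint : ∀ (G : ℝ[X]) (x : E3) (f : S2 → ℝ), Integrable f sphereMeasure →
      Integrable (fun y : S2 => G.eval (inner ℝ x (y : E3)) * f y) sphereMeasure :=
    fun G x f hf => integrable_smul_of_continuous (continuous_zonal G x) hf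
  have hcoord : ∀ (i : Fin 3) (f : S2 → ℝ), Integrable f sphereMeasure →
      Integrable (fun y : S2 => (y : E3) i * f y) sphereMeasure :=
    fun i f hf => integrable_smul_of_continuous (continuous_coord i) hf
  have hfi := integrable_coord hf
  choose P hP hP' using fun j => exists_zonal_potential q (fun y => f y j) (hfi j)
  -- Expanding `x·f(y) = ∑ x_j f_j(y)` reduces the potential to the scalar zonal potentials of the
  -- components.
  refine ⟨∑ j, MvPolynomial.X j * P j, fun x => ?_, fun x => ?_⟩
  · simp only [pe_sum, pe_mul, pe_X, hP]
    simp only [← integral_const_mul]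
    rw [← integral_finsetSum _ fun j _ => (hint _ _ _ (hfi j)).const_mul _]
    refine integral_congr_ae (Eventually.of_forall fun y => ?_)
    simp only [Fin.sum_univ_three]
    rw [inner_E3 x (f y)]
    ring
  · have hI : Integrable (fun y : S2 => ((derivative q).eval (inner ℝ x (y : E3)) *
        inner ℝ x (f y)) • (y : E3) + q.eval (inner ℝ x (y : E3)) • f y) sphereMeasure :=
      (integrable_smul_of_continuous' (hint _ _ _ (hf.const_inner x)) continuous_subtype_val).add
        (integrable_smul_of_continuous (continuous_zonal q x) hf)
    ext i
    have e1 : pgrad (∑ j, MvPolynomial.X j * P j) x i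
        = pe (P i) x + ∑ j, x j * pe (MvPolynomial.pderiv i (P j)) x := by
      simp only [pgrad, map_sum, Derivation.leibniz, smul_eq_mul, pe_sum, pe_add, pe_mul, pe_X,
        Finset.sum_add_distrib]
      rw [add_comm, Finset.sum_eq_single i]
      · simp
      · intro j _ hj; simp [MvPolynomial.pderiv_X_of_ne hj]
      · simp
    change _ = (EuclideanSpace.proj i : E3 →L[ℝ] ℝ) _
    rw [e1, ← ContinuousLinearMap.integral_comp_comm _ hI, hP]
    simp only [hP', ← integral_const_mul]
    rw [← integral_finsetSum _ fun j _ =>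
      (hint _ _ _ (hcoord i _ (hfi j))).const_mul _, ← integral_add
      (hint _ _ _ (hfi i)) (integrable_finsetSum _ fun j _ =>
      (hint _ _ _ (hcoord i _ (hfi j))).const_mul _)]
    refine integral_congr_ae (Eventually.of_forall fun y => ?_)
    have e3 : ∀ v : E3, (EuclideanSpace.proj i : E3 →L[ℝ] ℝ) v = v i := fun _ => rfl
    simp only [Fin.sum_univ_three, e3, PiLp.add_apply, PiLp.smul_apply, smul_eq_mul]
    rw [inner_E3 x (f y)]
    ring

end Potentials

/-! ### Action of the kernels and uniform limits of polynomial kernels -/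

section KernelAction

/-- The action of a matrix on Euclidean three-space. -/
def mv (A : Matrix (Fin 3) (Fin 3) ℝ) (w : E3) : E3 := WithLp.toLp 2 (A *ᵥ w.ofLp)

theorem mv_add_left (A B : Matrix (Fin 3) (Fin 3) ℝ) (w : E3) : mv (A + B) w = mv A w + mv B w := by
  simp [mv, Matrix.add_mulVec]

theorem mv_smul_left (c : ℝ) (A : Matrix (Fin 3) (Fin 3) ℝ) (w : E3) :
    mv (c • A) w = c • mv A w := by
  simp [mv, Matrix.smul_mulVec]

theorem mv_add_right (A : Matrix (Fin 3) (Fin 3) ℝ) (u w : E3) : mv A (u + w) = mv A u + mv A w := by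
  simp [mv, Matrix.mulVec_add]

theorem mv_smul_right (c : ℝ) (A : Matrix (Fin 3) (Fin 3) ℝ) (w : E3) :
    mv A (c • w) = c • mv A w := by
  simp [mv, Matrix.mulVec_smul]

theorem convIntegrand_eq (K : S2 → S2 → Matrix (Fin 3) (Fin 3) ℝ) (f : S2 → E3) (x y : S2) :
    convIntegrand K f x y = mv (K x y) (f y) := rfl

theorem mv_outer (a b w : E3) : mv (outer a b) w = inner ℝ b w • a := by
  ext i
  simp [mv, outer, Matrix.vecMulVec, Matrix.mulVec, dotProduct, Fin.sum_univ_three, inner_E3]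
  ring

theorem mv_matV (x y w : E3) : mv (matV x y) w
    = inner ℝ (x - inner ℝ x y • y) w • (y - inner ℝ x y • x) := mv_outer _ _ _

theorem mv_matW (x y w : E3) : mv (matW x y) w = tang x (tang y w) := by
  have h : ∀ a v : E3, mv (1 - outer a a) v = tang a v := fun a v => by
    rw [tang, ← mv_outer]
    simp [mv, Matrix.sub_mulVec]
  rw [← h x, ← h y]
  simp [mv, matW, Matrix.mulVec_mulVec]

theorem mv_matR (x y w : E3) : mv (matR x y) w = inner ℝ x y • w - inner ℝ x w • y := by
  rw [← mv_outer y x w]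
  simp [mv, matR, Matrix.sub_mulVec, Matrix.smul_mulVec]

theorem mv_matQ (x y w : E3) : mv (matQ x y) w = -(inner ℝ (cross x y) w • cross x y) := by
  rw [← mv_outer]
  simp [mv, matQ, Matrix.neg_mulVec]

theorem inner_mv_matV (x y u w : E3) :
    inner ℝ u (mv (matV x y) w) = inner ℝ (mv (matV y x) u) w := by
  rw [mv_matV, mv_matV, inner_smul_right, inner_smul_left, real_inner_comm x y,
    real_inner_comm u (y - _)]
  simp; ring

theorem inner_tang_right (x u w : E3) : inner ℝ u (tang x w) = inner ℝ (tang x u) w := by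
  simp only [tang, inner_sub_left, inner_sub_right, inner_smul_left, inner_smul_right]
  simp [real_inner_comm]; ring

theorem inner_mv_matW (x y u w : E3) :
    inner ℝ u (mv (matW x y) w) = inner ℝ (mv (matW y x) u) w := by
  rw [mv_matW, mv_matW, inner_tang_right, inner_tang_right]

theorem norm_sub_inner_smul_sq (x y : S2) :
    ‖(y : E3) - inner ℝ (x : E3) (y : E3) • (x : E3)‖ ^ 2 = 1 - inner ℝ (x : E3) (y : E3) ^ 2 := by
  rw [norm_sub_sq_real, inner_smul_right, norm_smul, norm_S2, norm_S2, Real.norm_eq_abs, mul_one,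
    sq_abs, real_inner_comm]
  ring

/-- The matrix has rank one, and both of its vectors have length `√(1-t²)`. This factor compensates
for the lack of control of `κ'` near `±1`. -/
theorem norm_mv_matV_le (x y : S2) (w : E3) :
    ‖mv (matV x y) w‖ ≤ (1 - inner ℝ (x : E3) (y : E3) ^ 2) * ‖w‖ := by
  rw [mv_matV, norm_smul, Real.norm_eq_abs]
  have h1 := norm_sub_inner_smul_sq x y
  have h2 := norm_sub_inner_smul_sq y x
  rw [real_inner_comm] at h2
  have h3 := abs_real_inner_le_norm ((x : E3) - inner ℝ (x : E3) (y : E3) • (y : E3)) w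
  have e : ‖(x : E3) - inner ℝ (x : E3) (y : E3) • (y : E3)‖
      = ‖(y : E3) - inner ℝ (x : E3) (y : E3) • (x : E3)‖ := by
    rw [← sq_eq_sq₀ (norm_nonneg _) (norm_nonneg _), h1, h2]
  rw [e] at h3
  calc _ ≤ ‖(y : E3) - inner ℝ (x : E3) (y : E3) • (x : E3)‖ * ‖w‖
        * ‖(y : E3) - inner ℝ (x : E3) (y : E3) • (x : E3)‖ :=
        mul_le_mul_of_nonneg_right h3 (norm_nonneg _)
    _ = _ := by rw [← h1]; ring

theorem norm_mv_matW_le (x y : S2) (w : E3) : ‖mv (matW x y) w‖ ≤ ‖w‖ := by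
  rw [mv_matW]; exact (norm_tang_le _ _).trans (norm_tang_le _ _)

/-- The divergence-free kernel is conjugate to the curl-free one by a quarter turn. -/
theorem mv_kernelDiv (ψ : ℝ → ℝ) (x y : S2) (w : E3) :
    mv (kernelDiv ψ x y) w = cross x (mv (kernelCurl ψ x y) (cross w y)) := by
  have hV : mv (matQ x y) w = cross x (mv (matV x y) (cross w y)) := by
    rw [mv_matV, mv_matQ]
    ext i
    fin_cases i <;> simp [cross_zero_coord, cross_one_coord, cross_two_coord, inner_E3] <;> ring
  have hW : mv (matR x y) w = cross x (mv (matW x y) (cross w y)) := by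
    rw [mv_matW, mv_matR, cross_tang]
    ext i
    fin_cases i <;>
      simp [cross_zero_coord, cross_one_coord, cross_two_coord, inner_E3, tang] <;> ring
  rw [kernelDiv, kernelCurl, mv_add_left, mv_smul_left, mv_smul_left, mv_add_left, mv_smul_left,
    mv_smul_left, cross_add_right, cross_smul_right, cross_smul_right, hV, hW]

open Polynomial in
/-- The curl-free kernel built from a polynomial `q` in place of `κ`. -/
def kernelPoly (q : ℝ[X]) (x y : S2) : Matrix (Fin 3) (Fin 3) ℝ :=
  (derivative q).eval (inner ℝ (x : E3) (y : E3)) • matV x y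
    + q.eval (inner ℝ (x : E3) (y : E3)) • matW x y

open Polynomial

theorem mv_kernelPoly (q : ℝ[X]) (x y : S2) (w : E3) : mv (kernelPoly q x y) w
    = (derivative q).eval (inner ℝ (x : E3) (y : E3)) • mv (matV x y) w
      + q.eval (inner ℝ (x : E3) (y : E3)) • mv (matW x y) w := by
  rw [kernelPoly, mv_add_left, mv_smul_left, mv_smul_left]

/-- The vector under the projection is the gradient in `x` of `q(x·y) (x·w)`, which exhibits the
convolution as a surface gradient. -/
theorem mv_kernelPoly_of_inner_eq_zero (q : ℝ[X]) (x y : S2) {w : E3}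
    (hw : inner ℝ (y : E3) w = 0) : mv (kernelPoly q x y) w
    = tang x (((derivative q).eval (inner ℝ (x : E3) (y : E3)) * inner ℝ (x : E3) w) • (y : E3)
      + q.eval (inner ℝ (x : E3) (y : E3)) • w) := by
  rw [mv_kernelPoly, mv_matV, mv_matW, tang_of_inner_eq_zero hw, inner_sub_left, inner_smul_left,
    hw, mul_zero, sub_zero, tang_add, tang_smul, tang_smul, smul_smul]
  rfl

/-- Exchanging the two points transposes the kernel; this makes the operator symmetric. -/
theorem inner_mv_kernelPoly (q : ℝ[X]) (x y : S2) (u w : E3) :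
    inner ℝ u (mv (kernelPoly q x y) w) = inner ℝ (mv (kernelPoly q y x) u) w := by
  rw [mv_kernelPoly, mv_kernelPoly, inner_add_right, inner_add_left, inner_smul_right,
    inner_smul_right, inner_smul_left, inner_smul_left, inner_mv_matV, inner_mv_matW,
    real_inner_comm (y : E3) (x : E3)]
  rfl

theorem exists_norm_mv_kernelPoly_le (q : ℝ[X]) :
    ∃ B, 0 ≤ B ∧ ∀ (x y : S2) (w : E3), ‖mv (kernelPoly q x y) w‖ ≤ B * ‖w‖ := by
  obtain ⟨B1, h1⟩ := isCompact_Icc.exists_bound_of_continuousOn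
    ((derivative q).continuous.continuousOn (s := Set.Icc (-1 : ℝ) 1))
  obtain ⟨B2, h2⟩ := isCompact_Icc.exists_bound_of_continuousOn
    (q.continuous.continuousOn (s := Set.Icc (-1 : ℝ) 1))
  have hB1 : 0 ≤ B1 := (norm_nonneg _).trans (h1 1 (by norm_num))
  have hB2 : 0 ≤ B2 := (norm_nonneg _).trans (h2 1 (by norm_num))
  refine ⟨B1 + B2, by positivity, fun x y w => ?_⟩
  have ht := inner_mem_Icc x y
  have hV : ‖mv (matV x y) w‖ ≤ ‖w‖ := by
    refine (norm_mv_matV_le x y w).trans (mul_le_of_le_one_left (norm_nonneg w) ?_)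
    nlinarith [sq_nonneg (inner ℝ (x : E3) (y : E3))]
  rw [mv_kernelPoly, add_mul]
  refine (norm_add_le _ _).trans (add_le_add ?_ ?_)
  · rw [norm_smul]
    exact mul_le_mul (h1 _ ht) hV (norm_nonneg _) hB1
  · rw [norm_smul]
    exact mul_le_mul (h2 _ ht) (norm_mv_matW_le x y w) (norm_nonneg _) hB2

theorem continuous_mv {X : Type*} [TopologicalSpace X] {A : X → Matrix (Fin 3) (Fin 3) ℝ}
    {f : X → E3} (hA : Continuous A) (hf : Continuous f) : Continuous fun z => mv (A z) (f z) := by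
  unfold mv
  exact (PiLp.continuous_toLp 2 _).comp (hA.matrix_mulVec ((PiLp.continuous_ofLp 2 _).comp hf))

theorem continuous_kernelPoly (q : ℝ[X]) : Continuous fun z : S2 × S2 => kernelPoly q z.1 z.2 := by
  have hout : ∀ {f g : S2 × S2 → E3}, Continuous f → Continuous g →
      Continuous fun z => outer (f z) (g z) := fun hf hg =>
    ((PiLp.continuous_ofLp 2 _).comp hf).matrix_vecMulVec ((PiLp.continuous_ofLp 2 _).comp hg)
  have h1 : Continuous fun z : S2 × S2 => (z.1 : E3) := by fun_prop
  have h2 : Continuous fun z : S2 × S2 => (z.2 : E3) := by fun_prop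
  have h3 := h1.inner h2 (𝕜 := ℝ)
  refine Continuous.add (Continuous.smul ((derivative q).continuous.comp h3) ?_)
    (Continuous.smul (q.continuous.comp h3) ?_)
  · exact hout (h2.sub (h3.smul h1)) (h1.sub (h3.smul h2))
  · exact (continuous_const.sub (hout h1 h1)).matrix_mul (continuous_const.sub (hout h2 h2))

theorem aestronglyMeasurable_mv {X : Type*} [TopologicalSpace X] [MeasurableSpace X]
    [OpensMeasurableSpace X] [SecondCountableTopology X]
    [TopologicalSpace.PseudoMetrizableSpace X] {μ : Measure X}
    {A : X → Matrix (Fin 3) (Fin 3) ℝ} {f : X → E3} (hA : Continuous A)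
    (hf : AEStronglyMeasurable f μ) : AEStronglyMeasurable (fun z => mv (A z) (f z)) μ := by
  have h : Continuous fun p : X × E3 => mv (A p.1) p.2 :=
    continuous_mv (hA.comp continuous_fst) continuous_snd
  exact h.comp_aestronglyMeasurable (continuous_id.aestronglyMeasurable.prodMk hf)

theorem integrable_convIntegrand_kernelPoly (q : ℝ[X]) {f : S2 → E3}
    (hf : Integrable f sphereMeasure) (x : S2) :
    Integrable (convIntegrand (kernelPoly q) f x) sphereMeasure := by
  obtain ⟨B, -, hB⟩ := exists_norm_mv_kernelPoly_le q
  exact (hf.norm.const_mul B).mono'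
    (aestronglyMeasurable_mv ((continuous_kernelPoly q).comp (Continuous.prodMk_right x)) hf.1)
    (Eventually.of_forall fun y => hB x y (f y))

/-- Convolution with a polynomial kernel is the surface gradient of a polynomial. -/
theorem exists_conv_kernelPoly_eq (q : ℝ[X]) {f : S2 → E3} (hf : Integrable f sphereMeasure)
    (ht : ∀ᵐ y : S2 ∂sphereMeasure, inner ℝ (y : E3) (f y) = 0) :
    ∃ P : MvPolynomial (Fin 3) ℝ,
      (∀ x : S2, pe P x = ∫ y : S2, q.eval (inner ℝ (x : E3) (y : E3)) * inner ℝ (x : E3) (f y)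
        ∂sphereMeasure) ∧
      ∀ x : S2, conv (kernelPoly q) f x = tang x (pgrad P x) := by
  obtain ⟨P, hP, hP'⟩ := exists_vector_potential q hf
  refine ⟨P, fun x => hP x, fun x => ?_⟩
  rw [hP', ← tangL_apply, ← ContinuousLinearMap.integral_comp_comm]
  · refine integral_congr_ae ?_
    filter_upwards [ht] with y hy
    rw [convIntegrand_eq, mv_kernelPoly_of_inner_eq_zero q x y hy, tangL_apply]
  · exact (integrable_smul_of_continuous' (integrable_smul_of_continuous
      (continuous_zonal (derivative q) x) (hf.const_inner (x : E3))) continuous_subtype_val).add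
        (integrable_smul_of_continuous (continuous_zonal q x) hf)

/-- Off the diagonal and antidiagonal, `k` is `ε`-close to the polynomial kernel of `q`. -/
def KernelClose (k : S2 → S2 → Matrix (Fin 3) (Fin 3) ℝ) (q : ℝ[X]) (ε : ℝ) : Prop :=
  ∀ x y : S2, inner ℝ (x : E3) (y : E3) ∈ Set.Ioo (-1 : ℝ) 1 → ∀ w,
    ‖mv (kernelPoly q x y) w - mv (k x y) w‖ ≤ ε * ‖w‖

/-- `k` is a uniform limit of polynomial kernels. -/
def KernelLimit (k : S2 → S2 → Matrix (Fin 3) (Fin 3) ℝ) : Prop :=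
  ∀ ε > 0, ∃ q, KernelClose k q ε

theorem ae_norm_sub_le {k : S2 → S2 → Matrix (Fin 3) (Fin 3) ℝ} {q : ℝ[X]} {ε : ℝ}
    (h : KernelClose k q ε) (f : S2 → E3) (x : S2) : ∀ᵐ y : S2 ∂sphereMeasure,
      ‖convIntegrand (kernelPoly q) f x y - convIntegrand k f x y‖ ≤ ε * ‖f y‖ := by
  filter_upwards [ae_ne_and_ne_neg x] with y hy using h x y hy (f y)

/-- Measurability comes from the a.e. limit of polynomial kernels. Integrability follows by
subtracting from one of them a difference dominated by a multiple of `‖f‖`. -/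
theorem KernelLimit.integrable {k : S2 → S2 → Matrix (Fin 3) (Fin 3) ℝ} (hk : KernelLimit k)
    {f : S2 → E3} (hf : Integrable f sphereMeasure) (x : S2) :
    Integrable (convIntegrand k f x) sphereMeasure := by
  have hpos : ∀ n : ℕ, (0 : ℝ) < 1 / (n + 1) := fun n => by positivity
  choose q hq using fun n : ℕ => hk (1 / (n + 1)) (hpos n)
  have hm : AEStronglyMeasurable (convIntegrand k f x) sphereMeasure := by
    refine aestronglyMeasurable_of_tendsto_ae atTop
      (fun n => (integrable_convIntegrand_kernelPoly (q n) hf x).1) ?_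
    have h := ae_all_iff.mpr fun n => ae_norm_sub_le (hq n) f x
    filter_upwards [h] with y hy
    rw [tendsto_iff_norm_sub_tendsto_zero]
    refine squeeze_zero (fun _ => norm_nonneg _) hy ?_
    simpa using tendsto_one_div_add_atTop_nhds_zero_nat.mul_const ‖f y‖
  have h1 : Integrable (fun y => convIntegrand (kernelPoly (q 0)) f x y - convIntegrand k f x y)
      sphereMeasure :=
    (hf.norm.const_mul _).mono' ((integrable_convIntegrand_kernelPoly (q 0) hf x).1.sub hm)
      (ae_norm_sub_le (hq 0) f x)
  exact ((integrable_convIntegrand_kernelPoly (q 0) hf x).sub h1).congr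
    (Eventually.of_forall fun y => by simp)

theorem KernelClose.norm_conv_sub_le {k : S2 → S2 → Matrix (Fin 3) (Fin 3) ℝ}
    (hk : KernelLimit k) {q : ℝ[X]} {ε : ℝ} (h : KernelClose k q ε) {f : S2 → E3}
    (hf : Integrable f sphereMeasure) (x : S2) :
    ‖conv (kernelPoly q) f x - conv k f x‖ ≤ ε * ∫ y, ‖f y‖ ∂sphereMeasure := by
  rw [conv, conv, ← integral_sub (integrable_convIntegrand_kernelPoly q hf x) (hk.integrable hf x),
    ← integral_const_mul]
  exact norm_integral_le_of_norm_le (hf.norm.const_mul _) (ae_norm_sub_le h f x)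

theorem KernelLimit.exists_close {k : S2 → S2 → Matrix (Fin 3) (Fin 3) ℝ} (hk : KernelLimit k)
    {f : S2 → E3} (hf : Integrable f sphereMeasure) {ε : ℝ} (hε : 0 < ε) :
    ∃ q, ∀ x, ‖conv (kernelPoly q) f x - conv k f x‖ ≤ ε := by
  have h0 : 0 ≤ ∫ y, ‖f y‖ ∂sphereMeasure := integral_nonneg fun _ => norm_nonneg _
  obtain ⟨q, hq⟩ := hk (ε / (∫ y, ‖f y‖ ∂sphereMeasure + 1)) (by positivity)
  refine ⟨q, fun x => (hq.norm_conv_sub_le hk hf x).trans ?_⟩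
  rw [div_mul_eq_mul_div, div_le_iff₀ (by positivity)]
  nlinarith

theorem continuous_conv_kernelPoly (q : ℝ[X]) {f : S2 → E3} (hf : Integrable f sphereMeasure)
    (ht : ∀ᵐ y : S2 ∂sphereMeasure, inner ℝ (y : E3) (f y) = 0) :
    Continuous (conv (kernelPoly q) f) := by
  obtain ⟨P, -, hP⟩ := exists_conv_kernelPoly_eq q hf ht
  rw [funext hP]
  exact continuous_tang continuous_subtype_val ((continuous_pgrad P).comp continuous_subtype_val)

theorem KernelLimit.continuous {k : S2 → S2 → Matrix (Fin 3) (Fin 3) ℝ} (hk : KernelLimit k)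
    {f : S2 → E3} (hf : Integrable f sphereMeasure)
    (ht : ∀ᵐ y : S2 ∂sphereMeasure, inner ℝ (y : E3) (f y) = 0) : Continuous (conv k f) := by
  refine continuous_of_uniform_approx_of_continuous fun u hu => ?_
  obtain ⟨ε, hε, h⟩ := Metric.mem_uniformity_dist.mp hu
  obtain ⟨q, hq⟩ := hk.exists_close hf (half_pos hε)
  refine ⟨_, continuous_conv_kernelPoly q hf ht, fun x => h ?_⟩
  rw [dist_comm, dist_eq_norm]
  exact (hq x).trans_lt (half_lt_self hε)

theorem KernelLimit.inner_conv {k : S2 → S2 → Matrix (Fin 3) (Fin 3) ℝ} (hk : KernelLimit k)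
    {f : S2 → E3} (hf : Integrable f sphereMeasure)
    (ht : ∀ᵐ y : S2 ∂sphereMeasure, inner ℝ (y : E3) (f y) = 0) (x : S2) :
    inner ℝ (x : E3) (conv k f x) = 0 := by
  rw [← abs_nonpos_iff]
  refine le_of_forall_pos_le_add fun ε hε => ?_
  obtain ⟨q, hq⟩ := hk.exists_close hf hε
  obtain ⟨P, -, hP⟩ := exists_conv_kernelPoly_eq q hf ht
  have h0 : inner ℝ (x : E3) (conv (kernelPoly q) f x) = 0 := by rw [hP, inner_tang]
  have h1 := abs_real_inner_le_norm (x : E3) (conv (kernelPoly q) f x - conv k f x)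
  rw [inner_sub_right, h0, zero_sub, abs_neg, norm_S2, one_mul] at h1
  linarith [hq x]

/-- A single polynomial kernel at distance `1` suffices, polynomial kernels being bounded. -/
theorem KernelLimit.exists_bound {k : S2 → S2 → Matrix (Fin 3) (Fin 3) ℝ} (hk : KernelLimit k) :
    ∃ B, 0 ≤ B ∧ ∀ f : S2 → E3, Integrable f sphereMeasure → ∀ x,
      ‖conv k f x‖ ≤ B * ∫ y, ‖f y‖ ∂sphereMeasure := by
  obtain ⟨q, hq⟩ := hk 1 one_pos
  obtain ⟨B, hB0, hB⟩ := exists_norm_mv_kernelPoly_le q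
  refine ⟨B + 1, by positivity, fun f hf x => ?_⟩
  have h1 := hq.norm_conv_sub_le hk hf x
  have h2 : ‖conv (kernelPoly q) f x‖ ≤ B * ∫ y, ‖f y‖ ∂sphereMeasure := by
    rw [← integral_const_mul]
    exact norm_integral_le_of_norm_le (hf.norm.const_mul _)
      (Eventually.of_forall fun y => hB x y (f y))
  have h3 := norm_sub_norm_le (conv k f x) (conv (kernelPoly q) f x)
  rw [norm_sub_rev] at h3
  linarith

end KernelAction

/-! ### Bounded symmetric operators on tangential fields -/

section TangentFields

theorem memLp_of_continuous {F : S2 → E3} (hF : Continuous F) : MemLp F 2 sphereMeasure := by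
  obtain ⟨M, hM⟩ := isCompact_univ.exists_bound_of_continuousOn (hF.continuousOn (s := Set.univ))
  exact MemLp.of_bound hF.aestronglyMeasurable M (Eventually.of_forall fun y => hM y trivial)

/-- The class of a continuous tangential field. -/
def toTangent (F : S2 → E3) (hF : Continuous F) (ht : ∀ x : S2, inner ℝ (x : E3) (F x) = 0) :
    TangentL2 :=
  ⟨(memLp_of_continuous hF).toLp F, by
    filter_upwards [(memLp_of_continuous hF).coeFn_toLp] with x hx
    rw [hx, ht]⟩

theorem represents_toTangent (F : S2 → E3) (hF : Continuous F)
    (ht : ∀ x : S2, inner ℝ (x : E3) (F x) = 0) : Represents (toTangent F hF ht) F :=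
  (memLp_of_continuous hF).coeFn_toLp

theorem Represents.ext {u v : TangentL2} {F : S2 → E3} (hu : Represents u F)
    (hv : Represents v F) : u = v :=
  Subtype.ext (Lp.ext (hu.trans hv.symm))

theorem Represents.add {u v : TangentL2} {F G : S2 → E3} (hu : Represents u F)
    (hv : Represents v G) : Represents (u + v) (fun x => F x + G x) := by
  filter_upwards [hu, hv, Lp.coeFn_add u.1 v.1] with x h1 h2 h3
  rw [Submodule.coe_add, h3, Pi.add_apply, h1, h2]

theorem Represents.smul {u : TangentL2} {F : S2 → E3} (c : ℝ) (hu : Represents u F) :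
    Represents (c • u) (fun x => c • F x) := by
  filter_upwards [hu, Lp.coeFn_smul c u.1] with x h1 h3
  rw [Submodule.coe_smul, h3, Pi.smul_apply, h1]

theorem Represents.sub {u v : TangentL2} {F G : S2 → E3} (hu : Represents u F)
    (hv : Represents v G) : Represents (u - v) (fun x => F x - G x) := by
  filter_upwards [hu, hv, Lp.coeFn_sub u.1 v.1] with x h1 h2 h3
  rw [Submodule.coe_sub, h3, Pi.sub_apply, h1, h2]

theorem represents_self (u : TangentL2) : Represents u u.1 := EventuallyEq.rfl

theorem integrable_tangent (f : TangentL2) : Integrable f.1 sphereMeasure :=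
  (Lp.memLp f.1).integrable (by norm_num)

theorem Represents.inner_eq {u v : TangentL2} {F G : S2 → E3} (hu : Represents u F)
    (hv : Represents v G) : inner ℝ u v = ∫ x, inner ℝ (F x) (G x) ∂sphereMeasure := by
  rw [Submodule.coe_inner, L2.inner_def]
  refine integral_congr_ae ?_
  filter_upwards [hu, hv] with x h1 h2
  rw [h1, h2]

theorem Represents.norm_le {u : TangentL2} {F : S2 → E3} (hu : Represents u F) {M : ℝ}
    (hM0 : 0 ≤ M) (hM : ∀ x, ‖F x‖ ≤ M) : ‖u‖ ≤ Real.sqrt (4 * Real.pi) * M := by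
  have h := Lp.norm_le_of_ae_bound (f := u.1) hM0 (by
    filter_upwards [hu] with x hx
    rw [hx]; exact hM x)
  have h' : (measureUnivNNReal sphereMeasure : ℝ) = 4 * Real.pi := sphereMeasure_real_univ
  rw [h'] at h
  refine h.trans_eq ?_
  rw [Real.sqrt_eq_rpow]
  norm_num

theorem integral_norm_le (f : TangentL2) :
    ∫ y, ‖f.1 y‖ ∂sphereMeasure ≤ Real.sqrt (4 * Real.pi) * ‖f‖ := by
  have h := eLpNorm_le_eLpNorm_mul_rpow_measure_univ (p := 1) (q := 2) (by norm_num)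
    (Lp.aestronglyMeasurable f.1)
  rw [integral_norm_eq_lintegral_enorm (Lp.aestronglyMeasurable f.1),
    ← eLpNorm_one_eq_lintegral_enorm]
  refine (ENNReal.toReal_mono (ENNReal.mul_ne_top (Lp.memLp f.1).2.ne 
    (ENNReal.rpow_ne_top_of_nonneg (by norm_num) (measure_ne_top _ _))) h).trans_eq ?_
  rw [ENNReal.toReal_mul, mul_comm, ← ENNReal.toReal_rpow, ← measureReal_def,
    sphereMeasure_real_univ, Real.sqrt_eq_rpow]
  congr 2
  norm_num

/-- A uniform limit of polynomial kernels acts as a bounded operator. -/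
theorem KernelLimit.exists_op {k : S2 → S2 → Matrix (Fin 3) (Fin 3) ℝ} (hk : KernelLimit k) :
    ∃ T : TangentL2 →L[ℝ] TangentL2, ∀ f, Represents (T f) (conv k f.1) := by
  obtain ⟨B, hB0, hB⟩ := hk.exists_bound
  let S : TangentL2 → TangentL2 := fun f => toTangent (conv k f.1)
    (hk.continuous (integrable_tangent f) f.2) (hk.inner_conv (integrable_tangent f) f.2)
  have hS : ∀ f, Represents (S f) (conv k f.1) := fun f => represents_toTangent _ _ _
  let L : TangentL2 →ₗ[ℝ] TangentL2 :=
    { toFun := S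
      map_add' := fun f g => by
        refine (hS _).ext (v := S f + S g) ?_
        refine Eq.mp (congrArg _ (funext fun x => ?_)) ((hS f).add (hS g))
        symm
        rw [conv, conv, conv, ← integral_add (hk.integrable (integrable_tangent f) x)
          (hk.integrable (integrable_tangent g) x)]
        refine integral_congr_ae ?_
        filter_upwards [Lp.coeFn_add f.1 g.1] with y hy
        rw [convIntegrand_eq, Submodule.coe_add, hy, Pi.add_apply, mv_add_right]; rfl
      map_smul' := fun c f => by
        refine (hS _).ext (v := c • S f) ?_
        refine Eq.mp (congrArg _ (funext fun x => ?_)) ((hS f).smul c)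
        symm
        rw [conv, conv, ← integral_smul]
        refine integral_congr_ae ?_
        filter_upwards [Lp.coeFn_smul c f.1] with y hy
        rw [convIntegrand_eq, Submodule.coe_smul, hy, Pi.smul_apply, mv_smul_right]; rfl }
  -- One factor `√(4π)` bounds the `L₁` norm of `f` by its `L₂` norm, the other the `L₂` norm of the
  -- image by its supremum.
  refine ⟨L.mkContinuous (Real.sqrt (4 * Real.pi) * (B * Real.sqrt (4 * Real.pi))) fun f => ?_, hS⟩
  have h1 := (hS f).norm_le (M := B * (Real.sqrt (4 * Real.pi) * ‖f‖)) (by positivity)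
    fun x => (hB f.1 (integrable_tangent f) x).trans
      (mul_le_mul_of_nonneg_left (integral_norm_le f) hB0)
  refine h1.trans_eq ?_
  ring

/-- Operators given by limits of polynomial kernels are symmetric. -/
theorem KernelLimit.symm {k : S2 → S2 → Matrix (Fin 3) (Fin 3) ℝ} (hk : KernelLimit k)
    {T : TangentL2 →L[ℝ] TangentL2} (hT : ∀ f, Represents (T f) (conv k f.1)) (f g : TangentL2) :
    inner ℝ (T f) g = inner ℝ f (T g) := by
  have hf := integrable_tangent f
  have hg := integrable_tangent g
  -- For polynomial kernels symmetry is Fubini together with the transposition rule.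
  have hpoly : ∀ q : Polynomial ℝ,
      ∫ x, inner ℝ (g.1 x) (conv (kernelPoly q) f.1 x) ∂sphereMeasure
        = ∫ y, inner ℝ (f.1 y) (conv (kernelPoly q) g.1 y) ∂sphereMeasure := fun q => by
    obtain ⟨B, -, hB⟩ := exists_norm_mv_kernelPoly_le q
    have hint : Integrable (Function.uncurry fun x y : S2 =>
        inner ℝ (g.1 x) (mv (kernelPoly q x y) (f.1 y))) (sphereMeasure.prod sphereMeasure) := by
      refine ((hg.norm.mul_prod hf.norm).const_mul B).mono' ?_ (Eventually.of_forall fun z => ?_)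
      · exact hg.1.comp_fst.inner (aestronglyMeasurable_mv (continuous_kernelPoly q) hf.1.comp_snd)
      · have h1 := abs_real_inner_le_norm (g.1 z.1) (mv (kernelPoly q z.1 z.2) (f.1 z.2))
        have h2 := mul_le_mul_of_nonneg_left (hB z.1 z.2 (f.1 z.2)) (norm_nonneg (g.1 z.1))
        rw [Function.uncurry, Real.norm_eq_abs]
        linarith
    calc _ = ∫ x, ∫ y, inner ℝ (g.1 x) (mv (kernelPoly q x y) (f.1 y)) ∂sphereMeasure
          ∂sphereMeasure := by
          refine integral_congr_ae (Eventually.of_forall fun x => ?_)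
          exact (integral_inner (integrable_convIntegrand_kernelPoly q hf x) (g.1 x)).symm
      _ = ∫ y, ∫ x, inner ℝ (g.1 x) (mv (kernelPoly q x y) (f.1 y)) ∂sphereMeasure
          ∂sphereMeasure := integral_integral_swap hint
      _ = _ := by
          refine integral_congr_ae (Eventually.of_forall fun y => ?_)
          refine Eq.trans ?_ (integral_inner (integrable_convIntegrand_kernelPoly q hg y) (f.1 y))
          refine integral_congr_ae (Eventually.of_forall fun x => ?_)
          change inner ℝ (g.1 x) _ = _
          rw [inner_mv_kernelPoly, real_inner_comm]; rfl
  have hclose : ∀ ε > 0, ∀ u v : TangentL2, ∀ q, (∀ x, ‖conv (kernelPoly q) u.1 x - conv k u.1 x‖ ≤ ε) →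
      |∫ x, inner ℝ (v.1 x) (conv (kernelPoly q) u.1 x) ∂sphereMeasure - inner ℝ v (T u)|
        ≤ Real.sqrt (4 * Real.pi) * ε * ‖v‖ := fun ε hε u v q hq => by
    have hc := continuous_conv_kernelPoly q (integrable_tangent u) u.2
    have htan : ∀ x : S2, inner ℝ (x : E3) (conv (kernelPoly q) u.1 x) = 0 := fun x => by
      obtain ⟨P, -, hP⟩ := exists_conv_kernelPoly_eq q (integrable_tangent u) u.2
      rw [hP, inner_tang]
    have hr := represents_toTangent _ hc htan
    rw [← (represents_self v).inner_eq hr, ← inner_sub_right]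
    refine (abs_real_inner_le_norm _ _).trans ?_
    rw [mul_comm]
    exact mul_le_mul_of_nonneg_right ((hr.sub (hT u)).norm_le hε.le hq) (norm_nonneg v)
  rw [real_inner_comm, ← sub_eq_zero, ← abs_nonpos_iff]
  refine le_of_forall_pos_le_add fun ε hε => ?_
  obtain ⟨δ, hδ, hδε⟩ : ∃ δ > 0, Real.sqrt (4 * Real.pi) * δ * (‖f‖ + ‖g‖) ≤ ε := by
    refine ⟨ε / (Real.sqrt (4 * Real.pi) * (‖f‖ + ‖g‖ + 1)), by positivity, ?_⟩
    rw [mul_div_assoc', div_mul_eq_mul_div, div_le_iff₀ (by positivity)]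
    have : 0 ≤ ε * Real.sqrt (4 * Real.pi) := by positivity
    nlinarith
  have h0 : 0 ≤ ∫ y, ‖f.1 y‖ ∂sphereMeasure := integral_nonneg fun _ => norm_nonneg _
  have h0' : 0 ≤ ∫ y, ‖g.1 y‖ ∂sphereMeasure := integral_nonneg fun _ => norm_nonneg _
  -- One `q` has to serve both fields, hence the sum of both `L₁` norms; the added `1` keeps the
  -- denominator positive.
  obtain ⟨q, hq⟩ := hk (δ / (∫ y, ‖f.1 y‖ ∂sphereMeasure + ∫ y, ‖g.1 y‖ ∂sphereMeasure + 1))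
    (by positivity)
  have h1 := hclose δ hδ f g q fun x => (hq.norm_conv_sub_le hk hf x).trans (by
    rw [div_mul_eq_mul_div, div_le_iff₀ (by positivity)]; nlinarith)
  have h2 := hclose δ hδ g f q fun x => (hq.norm_conv_sub_le hk hg x).trans (by
    rw [div_mul_eq_mul_div, div_le_iff₀ (by positivity)]; nlinarith)
  rw [hpoly q] at h1
  rw [abs_le] at h1 h2 ⊢
  constructor <;> nlinarith [h1.1, h1.2, h2.1, h2.2]

end TangentFields

/-! ### Approximation of `ψ`, `κ` and the kernel by polynomials -/

section Approximation

open Polynomial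

/-- The Archimedean hat-box theorem for continuous functions. -/
theorem integral_zonal_of_continuous {ψ : ℝ → ℝ} (hψ : Continuous ψ) (a : S2) :
    ∫ y : S2, ψ (inner ℝ (a : E3) (y : E3)) ∂sphereMeasure
      = 2 * Real.pi * ∫ t in (-1 : ℝ)..1, ψ t := by
  rw [← sub_eq_zero, ← abs_nonpos_iff]
  refine le_of_forall_pos_le_add fun ε hε => ?_
  -- The sphere has mass `4π` and the interval, weighted by `2π`, also has mass `4π`; with `ε/(8π)`
  -- each error is at most `ε/2`.
  obtain ⟨p, hp⟩ := exists_polynomial_near_of_continuousOn (-1) 1 ψ hψ.continuousOn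
    (ε / (8 * Real.pi)) (by positivity)
  have h1 : |∫ y : S2, ψ (inner ℝ (a : E3) (y : E3)) ∂sphereMeasure
      - ∫ y : S2, p.eval (inner ℝ (a : E3) (y : E3)) ∂sphereMeasure|
        ≤ ε / (8 * Real.pi) * (4 * Real.pi) := by
    rw [← integral_sub (integrable_sphere (by fun_prop)) (integrable_sphere (continuous_zonal p a)),
      ← sphereMeasure_real_univ, ← Real.norm_eq_abs]
    refine norm_integral_le_of_norm_le_const (Eventually.of_forall fun y => ?_)
    rw [norm_sub_rev]
    exact (hp _ (inner_mem_Icc a y)).le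
  have h2 : |(∫ t in (-1 : ℝ)..1, ψ t) - polyInt p| ≤ ε / (8 * Real.pi) * 2 := by
    rw [polyInt_apply, ← intervalIntegral.integral_sub (hψ.intervalIntegrable _ _)
      (p.continuous.intervalIntegrable _ _), ← Real.norm_eq_abs]
    refine (intervalIntegral.norm_integral_le_of_norm_le_const (C := ε / (8 * Real.pi))
      fun t ht => ?_).trans_eq (by norm_num)
    rw [Set.uIoc_of_le (by norm_num)] at ht
    rw [norm_sub_rev]
    exact (hp t ⟨ht.1.le, ht.2⟩).le
  rw [integral_zonal] at h1
  have h3 := mul_le_mul_of_nonneg_left h2 (show 0 ≤ 2 * Real.pi by positivity)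
  rw [← abs_of_nonneg (show 0 ≤ 2 * Real.pi by positivity), ← abs_mul,
    abs_of_nonneg (show 0 ≤ 2 * Real.pi by positivity)] at h3
  have e1 : ε / (8 * Real.pi) * (4 * Real.pi) = ε / 2 := by field_simp; norm_num
  have e2 : 2 * Real.pi * (ε / (8 * Real.pi) * 2) = ε / 2 := by field_simp; norm_num
  rw [e1] at h1
  rw [e2] at h3
  rw [abs_le] at *
  constructor <;> linarith [h1.1, h1.2, h3.1, h3.2]

theorem continuous_scaledKernel {φ : ℝ → ℝ} (hφ : ContinuousOn φ (Set.Ici 0)) (C : ℝ) {ρ : ℝ}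
    (hρ : 0 < ρ) : Continuous (scaledKernel φ C ρ) := by
  unfold scaledKernel
  refine continuous_const.mul (hφ.comp_continuous (by fun_prop) fun t => ?_)
  exact mul_nonneg (inv_nonneg.mpr hρ.le) (Real.sqrt_nonneg _)

/-- The primitive of `1/(4π) - ψ` vanishing at `-1`. -/
def kappaPrim (ψ : ℝ → ℝ) (t : ℝ) : ℝ := ∫ s in (-1 : ℝ)..t, (1 / (4 * Real.pi) - ψ s)

theorem hasDerivAt_kappaPrim {ψ : ℝ → ℝ} (hψ : Continuous ψ) (t : ℝ) :
    HasDerivAt (kappaPrim ψ) (1 / (4 * Real.pi) - ψ t) t :=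
  ((continuous_const.sub hψ).integral_hasStrictDerivAt (-1) t).hasDerivAt

theorem hasDerivAt_kappa_formula {ψ : ℝ → ℝ} (hψ : Continuous ψ) {t : ℝ}
    (ht : t ∈ Set.Ioo (-1 : ℝ) 1) :
    HasDerivAt (fun t => (1 - t ^ 2)⁻¹ * kappaPrim ψ t)
      (2 * t / (1 - t ^ 2) ^ 2 * kappaPrim ψ t + (1 - t ^ 2)⁻¹ * (1 / (4 * Real.pi) - ψ t)) t := by
  have h0 : 1 - t ^ 2 ≠ 0 := by nlinarith [ht.1, ht.2]
  have h1 : HasDerivAt (fun t : ℝ => 1 - t ^ 2) (-(2 * t)) t := by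
    simpa using (hasDerivAt_pow 2 t).const_sub 1
  convert! (h1.inv h0).mul (hasDerivAt_kappaPrim hψ t) using 1
  rw [show ((fun t : ℝ => 1 - t ^ 2)⁻¹) t = (1 - t ^ 2)⁻¹ from rfl]
  ring

/-- The formula is continuous inside the interval, so extension by limits does not change it there.
Only interior values of `κ` are used. -/
theorem kappa_eq {ψ : ℝ → ℝ} (hψ : Continuous ψ) {t : ℝ} (ht : t ∈ Set.Ioo (-1 : ℝ) 1) :
    kappa ψ t = (1 - t ^ 2)⁻¹ * kappaPrim ψ t := by
  have hfun : (fun t : ℝ => (4 * Real.pi * (1 - t ^ 2))⁻¹ *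
      ∫ s in (-1 : ℝ)..t, (1 - 4 * Real.pi * ψ s)) = fun t => (1 - t ^ 2)⁻¹ * kappaPrim ψ t := by
    ext t
    have : ∫ s in (-1 : ℝ)..t, (1 - 4 * Real.pi * ψ s) = 4 * Real.pi * kappaPrim ψ t := by
      rw [kappaPrim, ← intervalIntegral.integral_const_mul]
      congr 1
      ext s
      field_simp
    rw [this, mul_inv]
    field_simp
  rw [kappa, hfun]
  refine extendFrom_eq (subset_closure ht) ?_
  exact (hasDerivAt_kappa_formula hψ ht).continuousAt.tendsto.mono_left nhdsWithin_le_nhds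

theorem one_sub_sq_mul_kappa {ψ : ℝ → ℝ} (hψ : Continuous ψ) {t : ℝ}
    (ht : t ∈ Set.Ioo (-1 : ℝ) 1) : (1 - t ^ 2) * kappa ψ t = kappaPrim ψ t := by
  have h0 : 1 - t ^ 2 ≠ 0 := by nlinarith [ht.1, ht.2]
  rw [kappa_eq hψ ht]; field_simp

/-- The product rule for `(1-t²)κ`, in the form matching `(1-t²)G'' = 2tG' + legOp G`. -/
theorem one_sub_sq_mul_deriv_kappa {ψ : ℝ → ℝ} (hψ : Continuous ψ) {t : ℝ}
    (ht : t ∈ Set.Ioo (-1 : ℝ) 1) :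
    (1 - t ^ 2) * deriv (kappa ψ) t = 2 * t * kappa ψ t + (1 / (4 * Real.pi) - ψ t) := by
  have h0 : 1 - t ^ 2 ≠ 0 := by nlinarith [ht.1, ht.2]
  have h1 : kappa ψ =ᶠ[𝓝 t] fun t => (1 - t ^ 2)⁻¹ * kappaPrim ψ t := by
    filter_upwards [isOpen_Ioo.mem_nhds ht] with s hs using kappa_eq hψ hs
  rw [h1.deriv_eq, (hasDerivAt_kappa_formula hψ ht).deriv, kappa_eq hψ ht]
  field_simp

theorem integral_legOp (G : ℝ[X]) (t : ℝ) :
    ∫ s in (-1 : ℝ)..t, (legOp G).eval s = (1 - t ^ 2) * (derivative G).eval t := by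
  have h : ∫ s in (-1 : ℝ)..t, (legOp G).eval s
      = ((1 - X ^ 2) * derivative G).eval t - ((1 - X ^ 2) * derivative G).eval (-1) :=
    intervalIntegral.integral_eq_sub_of_hasDerivAt
      (fun t _ => ((1 - X ^ 2) * derivative G : ℝ[X]).hasDerivAt t)
      ((legOp G).continuous.intervalIntegrable _ _)
  rw [h]; simp

/-- `G` approximates `ψ` through `1/(4π) - legOp G`. -/
def LegendreClose (ψ : ℝ → ℝ) (G : ℝ[X]) (δ : ℝ) : Prop :=
  ∀ t ∈ Set.Icc (-1 : ℝ) 1, |1 / (4 * Real.pi) - (legOp G).eval t - ψ t| ≤ δ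

/-- Weierstrass gives a polynomial `c - legOp G` within `δ/2` of `ψ`. As `legOp G` has mean zero and
`∫ ψ = 1/(2π)`, comparing integrals gives `|c - 1/(4π)| ≤ δ/2`. -/
theorem exists_legendreClose {ψ : ℝ → ℝ} (hψ : Continuous ψ)
    (hint : 2 * Real.pi * ∫ t in (-1 : ℝ)..1, ψ t = 1) {δ : ℝ} (hδ : 0 < δ) :
    ∃ G, LegendreClose ψ G δ := by
  obtain ⟨p, hp⟩ := exists_polynomial_near_of_continuousOn (-1) 1 ψ hψ.continuousOn (δ / 2)
    (by positivity)
  obtain ⟨c, G, h⟩ := exists_eq_C_sub_legOp p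
  have h2 : |polyInt p - ∫ t in (-1 : ℝ)..1, ψ t| ≤ δ / 2 * 2 := by
    rw [polyInt_apply, ← intervalIntegral.integral_sub (p.continuous.intervalIntegrable _ _)
      (hψ.intervalIntegrable _ _), ← Real.norm_eq_abs]
    refine (intervalIntegral.norm_integral_le_of_norm_le_const (C := δ / 2)
      fun t ht => ?_).trans_eq (by norm_num)
    rw [Set.uIoc_of_le (by norm_num)] at ht
    exact (hp t ⟨ht.1.le, ht.2⟩).le
  have h3 : polyInt p = 2 * c := by
    rw [h, map_sub, polyInt_legOp, polyInt_apply]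
    simp only [eval_C]
    rw [intervalIntegral.integral_const, smul_eq_mul]; ring
  have h4 : ∫ t in (-1 : ℝ)..1, ψ t = 2 * (1 / (4 * Real.pi)) := by
    have := Real.pi_pos
    field_simp
    linarith
  refine ⟨G, fun t ht => ?_⟩
  have h5 := hp t ht
  rw [h, eval_sub, eval_C] at h5
  rw [h3, h4] at h2
  rw [abs_lt] at h5
  rw [abs_le] at h2 ⊢
  constructor <;> linarith [h5.1, h5.2, h2.1, h2.2]

/-- The residual `r` has mean zero and `|r| ≤ δ`, and `(1-t²)(κ - G')` is its integral from `-1` to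
`t`. Integrating from the nearer endpoint bounds this by `δ(1-|t|)`; division by `1-t²` leaves
`δ/(1+|t|) ≤ δ`. -/
theorem LegendreClose.abs_sub_kappa_le {ψ : ℝ → ℝ} (hψ : Continuous ψ)
    (hint : 2 * Real.pi * ∫ t in (-1 : ℝ)..1, ψ t = 1) {G : ℝ[X]} {δ : ℝ}
    (hG : LegendreClose ψ G δ) {t : ℝ} (ht : t ∈ Set.Ioo (-1 : ℝ) 1) :
    |(derivative G).eval t - kappa ψ t| ≤ δ := by
  set r : ℝ → ℝ := fun s => 1 / (4 * Real.pi) - (legOp G).eval s - ψ s with hr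
  have hrc : Continuous r := by
    have := (legOp G).continuous
    fun_prop
  have hδ0 : 0 ≤ δ := (abs_nonneg _).trans (hG 0 (by norm_num))
  have hprim : ∀ u : ℝ, ∫ s in (-1 : ℝ)..u, r s
      = kappaPrim ψ u - (1 - u ^ 2) * (derivative G).eval u := fun u => by
    have hc : Continuous fun s => 1 / (4 * Real.pi) - ψ s := by fun_prop
    rw [← integral_legOp, kappaPrim, ← intervalIntegral.integral_sub (hc.intervalIntegrable _ _)
      ((legOp G).continuous.intervalIntegrable _ _)]
    congr 1; ext s; rw [hr]; ring
  have h1 : ∫ s in (-1 : ℝ)..1, r s = 0 := by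
    rw [hprim, kappaPrim, intervalIntegral.integral_sub (by simp) (hψ.intervalIntegrable _ _)]
    have := Real.pi_pos
    simp
    field_simp
    linarith
  have hl : |∫ s in (-1 : ℝ)..t, r s| ≤ δ * (1 + t) := by
    rw [← Real.norm_eq_abs]
    refine (intervalIntegral.norm_integral_le_of_norm_le_const (C := δ)
      fun s hs => ?_).trans_eq (by rw [abs_of_pos (by linarith [ht.1])]; ring)
    rw [Set.uIoc_of_le ht.1.le] at hs
    exact hG s ⟨hs.1.le, hs.2.trans ht.2.le⟩
  have hu : |∫ s in (-1 : ℝ)..t, r s| ≤ δ * (1 - t) := by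
    have h2 := intervalIntegral.integral_add_adjacent_intervals
      (hrc.intervalIntegrable (μ := volume) (-1) t) (hrc.intervalIntegrable t 1)
    rw [h1] at h2
    rw [eq_neg_of_add_eq_zero_left h2, abs_neg, ← Real.norm_eq_abs]
    refine (intervalIntegral.norm_integral_le_of_norm_le_const (C := δ)
      fun s hs => ?_).trans_eq (by rw [abs_of_pos (by linarith [ht.2])])
    rw [Set.uIoc_of_le ht.2.le] at hs
    exact hG s ⟨ht.1.le.trans hs.1.le, hs.2⟩
  have hD : ∫ s in (-1 : ℝ)..t, r s = -((1 - t) * (1 + t) * ((derivative G).eval t - kappa ψ t)) := by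
    rw [hprim, ← one_sub_sq_mul_kappa hψ ht]; ring
  rw [hD, abs_neg, abs_mul, abs_mul, abs_of_pos (by linarith [ht.2] : 0 < 1 - t),
    abs_of_pos (by linarith [ht.1] : 0 < 1 + t)] at hl hu
  set d := |(derivative G).eval t - kappa ψ t|
  have hd : 0 ≤ d := abs_nonneg _
  by_cases h0 : 0 ≤ t
  · have h3 : (1 + t) * d ≤ δ := by
      refine le_of_mul_le_mul_left ?_ (by linarith [ht.2] : 0 < 1 - t)
      linarith
    nlinarith
  · have h3 : (1 - t) * d ≤ δ := by
      refine le_of_mul_le_mul_left ?_ (by linarith [ht.1] : 0 < 1 + t)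
      linarith
    nlinarith

/-- Subtracting the two product rules bounds `(1-t²)|G'' - κ'|` by `2δ + δ`, and the factor `1-t²`
is supplied by `V`. The `W` term adds another `δ`. -/
theorem LegendreClose.kernelClose {ψ : ℝ → ℝ} (hψ : Continuous ψ)
    (hint : 2 * Real.pi * ∫ t in (-1 : ℝ)..1, ψ t = 1) {G : ℝ[X]} {δ : ℝ}
    (hG : LegendreClose ψ G δ) : KernelClose (kernelCurl ψ) (derivative G) (4 * δ) := by
  intro x y ht w
  have h1 := hG.abs_sub_kappa_le hψ hint ht
  have h2 := hG _ (Set.Ioo_subset_Icc_self ht)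
  have h3 := one_sub_sq_mul_deriv_kappa hψ ht
  have h4 := norm_mv_matV_le x y w
  have h5 := norm_mv_matW_le x y w
  rw [mv_kernelPoly, kernelCurl, mv_add_left, mv_smul_left, mv_smul_left]
  rw [legOp_eq] at h2
  simp only [eval_sub, eval_mul, eval_one, eval_pow, eval_X, eval_ofNat] at h2
  generalize inner ℝ (x : E3) (y : E3) = t at *
  have hpos : 0 < 1 - t ^ 2 := by nlinarith [ht.1, ht.2]
  have h6 : (1 - t ^ 2) * |(derivative (derivative G)).eval t - deriv (kappa ψ) t| ≤ 3 * δ := by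
    rw [← abs_of_pos hpos, ← abs_mul, mul_sub, h3]
    rw [abs_le] at *
    constructor <;> nlinarith [h1.1, h1.2, h2.1, h2.2, ht.1, ht.2]
  have e : (derivative (derivative G)).eval t • mv (matV x y) w
        + (derivative G).eval t • mv (matW x y) w
        - (deriv (kappa ψ) t • mv (matV x y) w + kappa ψ t • mv (matW x y) w)
      = ((derivative (derivative G)).eval t - deriv (kappa ψ) t) • mv (matV x y) w
        + ((derivative G).eval t - kappa ψ t) • mv (matW x y) w := by module
  rw [e]
  refine (norm_add_le _ _).trans ?_
  rw [norm_smul, norm_smul, Real.norm_eq_abs, Real.norm_eq_abs]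
  have h7 : |(derivative (derivative G)).eval t - deriv (kappa ψ) t| * ‖mv (matV x y) w‖
      ≤ 3 * δ * ‖w‖ := by
    refine (mul_le_mul_of_nonneg_left h4 (abs_nonneg _)).trans ?_
    rw [← mul_assoc, mul_comm _ (1 - t ^ 2)]
    exact mul_le_mul_of_nonneg_right h6 (norm_nonneg w)
  have h8 : |(derivative G).eval t - kappa ψ t| * ‖mv (matW x y) w‖ ≤ δ * ‖w‖ :=
    mul_le_mul h1 h5 (norm_nonneg _) ((abs_nonneg _).trans h1)
  linarith

theorem kernelLimit_kernelCurl {ψ : ℝ → ℝ} (hψ : Continuous ψ)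
    (hint : 2 * Real.pi * ∫ t in (-1 : ℝ)..1, ψ t = 1) : KernelLimit (kernelCurl ψ) := by
  intro ε hε
  obtain ⟨G, hG⟩ := exists_legendreClose hψ hint (δ := ε / 4) (by positivity)
  have h := hG.kernelClose hψ hint
  exact ⟨_, by rwa [mul_div_cancel₀ _ (by norm_num)] at h⟩

/-- By Legendre's equation `ℓ(ℓ+1) ∫ G P_ℓ = -∫ (legOp G) P_ℓ`, and the constant `1/(4π)` is
orthogonal to `P_ℓ` because `ℓ ≥ 1`. What remains is the residual integrated against `P_ℓ`. -/
theorem exists_abs_legendreCoeff_sub_le {ψ : ℝ → ℝ} (hψ : Continuous ψ) {ℓ : ℕ} (hℓ : 1 ≤ ℓ) :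
    ∃ M, 0 ≤ M ∧ ∀ G δ, LegendreClose ψ G δ →
      |(ℓ : ℝ) * (ℓ + 1) * (2 * Real.pi * legInt ℓ G) - legendreCoeff ψ ℓ| ≤ M * δ := by
  obtain ⟨B, hB⟩ := isCompact_Icc.exists_bound_of_continuousOn
    ((legendrePoly ℓ).continuous.continuousOn (s := Set.Icc (-1 : ℝ) 1))
  have hB0 : 0 ≤ B := (norm_nonneg _).trans (hB 1 (by norm_num))
  refine ⟨2 * Real.pi * (B * 2), by positivity, fun G δ hG => ?_⟩
  have hPc := (legendrePoly ℓ).continuous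
  have hGc := (legOp G).continuous
  have e : (ℓ : ℝ) * (ℓ + 1) * (2 * Real.pi * legInt ℓ G) - legendreCoeff ψ ℓ
      = 2 * Real.pi * ∫ t in (-1 : ℝ)..1,
        (1 / (4 * Real.pi) - (legOp G).eval t - ψ t) * (legendrePoly ℓ).eval t := by
    have h1 := legInt_legOp ℓ G
    have h2 := legInt_one hℓ
    rw [legInt_apply, polyInt_apply] at h1 h2
    simp only [eval_mul, one_mul] at h1 h2
    simp only [sub_mul]
    rw [intervalIntegral.integral_sub (Continuous.intervalIntegrable (by fun_prop) _ _)
      (Continuous.intervalIntegrable (by fun_prop) _ _),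
      intervalIntegral.integral_sub (Continuous.intervalIntegrable (by fun_prop) _ _)
      (Continuous.intervalIntegrable (by fun_prop) _ _), intervalIntegral.integral_const_mul, h2,
      legendreCoeff]
    simp only [legendreP_eq]
    linear_combination (2 * Real.pi) * h1
  rw [e, abs_mul, abs_of_pos Real.two_pi_pos, mul_assoc (2 * Real.pi) (B * 2) δ]
  refine mul_le_mul_of_nonneg_left ?_ (by positivity)
  rw [← Real.norm_eq_abs]
  refine (intervalIntegral.norm_integral_le_of_norm_le_const (C := δ * B)
    fun s hs => ?_).trans_eq (by norm_num; ring)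
  rw [Set.uIoc_of_le (by norm_num)] at hs
  have hs' : s ∈ Set.Icc (-1 : ℝ) 1 := ⟨hs.1.le, hs.2⟩
  rw [norm_mul]
  exact mul_le_mul (hG s hs') (hB s hs') (norm_nonneg _) ((abs_nonneg _).trans (hG s hs'))

end Approximation

/-! ### Action on gradients and curls of spherical harmonics -/

section Multipliers

open Polynomial

theorem pgrad_zonal (G : ℝ[X]) (a y : E3) :
    pgrad (zonal G a) y = (derivative G).eval (inner ℝ a y) • a := by
  ext i
  simp [pgrad, pderiv_zonal, pe_zonal]
  ring

theorem inner_tang_pgrad_zonal (G : ℝ[X]) (a y : E3) {w : E3} (hw : inner ℝ y w = 0) :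
    inner ℝ (tang y (pgrad (zonal G a) y)) w = (derivative G).eval (inner ℝ a y) * inner ℝ a w := by
  rw [pgrad_zonal, tang, inner_sub_left, inner_smul_left, inner_smul_left, hw]
  simp

theorem continuous_surfGrad_field (p : MvPolynomial (Fin 3) ℝ) :
    Continuous fun y : S2 => tang y (pgrad p y) :=
  continuous_tang continuous_subtype_val ((continuous_pgrad p).comp continuous_subtype_val)

theorem continuous_surfCurl_field (p : MvPolynomial (Fin 3) ℝ) :
    Continuous fun y : S2 => cross y (pgrad p y) :=
  continuous_cross continuous_subtype_val ((continuous_pgrad p).comp continuous_subtype_val)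

/-- The surface gradient sees only the restriction to the sphere, so potentials need to agree only
there. -/
theorem tang_pgrad_congr {P Q : MvPolynomial (Fin 3) ℝ} (h : ∀ x : S2, pe P x = pe Q x) (x : S2) :
    tang x (pgrad P x) = tang x (pgrad Q x) := by
  rw [← surfGrad_pe, ← surfGrad_pe, funext h]

theorem pgrad_C_mul (c : ℝ) (p : MvPolynomial (Fin 3) ℝ) (y : E3) :
    pgrad (MvPolynomial.C c * p) y = c • pgrad p y := by
  ext i; simp [pgrad]

/-- The potential at `a` is `∫ ⟨∇_* G(a·y), ∇_* p⟩ = ℓ(ℓ+1) ∫ G(a·y) p(y)` by Green's formula, which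
Funk–Hecke evaluates. -/
theorem conv_kernelPoly_surfGrad {ℓ : ℕ} {p : MvPolynomial (Fin 3) ℝ} (hp : p.IsHomogeneous ℓ)
    (hΔ : ∑ i, MvPolynomial.pderiv i (MvPolynomial.pderiv i p) = 0) (G : ℝ[X]) (x : S2) :
    conv (kernelPoly (derivative G)) (fun y => tang y (pgrad p y)) x
      = ((ℓ : ℝ) * (ℓ + 1) * (2 * Real.pi * legInt ℓ G)) • tang x (pgrad p x) := by
  obtain ⟨P, hP, hP'⟩ := exists_conv_kernelPoly_eq (derivative G)
    (integrable_sphere (continuous_surfGrad_field p)) (Eventually.of_forall fun y => inner_tang y _)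
  set c := (ℓ : ℝ) * (ℓ + 1) * (2 * Real.pi * legInt ℓ G) with hc
  have h : ∀ a : S2, pe P a = pe (MvPolynomial.C c * p) a := fun a => by
    have h1 := integral_inner_tang_pgrad (zonal G a) p
    simp only [fun y : S2 => inner_tang_pgrad_zonal G a y (inner_tang y (pgrad p y))] at h1
    rw [hP, h1, sphLap_harmonic hp hΔ, pe_mul, pe_C, hc, mul_assoc, ← funkHecke hp hΔ a G,
      ← integral_const_mul, ← integral_neg]
    refine integral_congr_ae (Eventually.of_forall fun y => ?_)
    simp only [pe_neg, pe_mul, pe_C, pe_zonal]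
    ring
  rw [hP', tang_pgrad_congr h, pgrad_C_mul, tang_smul]

/-- The potential at `a` pairs the surface gradient of `G(a·y)` with a surface curl, hence is zero.
-/
theorem conv_kernelPoly_surfCurl (p : MvPolynomial (Fin 3) ℝ) (G : ℝ[X]) (x : S2) :
    conv (kernelPoly (derivative G)) (fun y => cross y (pgrad p y)) x = 0 := by
  obtain ⟨P, hP, hP'⟩ := exists_conv_kernelPoly_eq (derivative G)
    (integrable_sphere (continuous_surfCurl_field p))
    (Eventually.of_forall fun y => inner_cross_self_left y _)
  have h : ∀ a : S2, pe P a = pe 0 a := fun a => by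
    have h1 := integral_inner_surfGrad_surfCurl
      ((contDiff_pe (zonal G a)).of_le (by norm_cast)) p
    simp only [gradient_pe, fun y : S2 => inner_tang_pgrad_zonal G a y
      (inner_cross_self_left (y : E3) (pgrad p y))] at h1
    rw [hP, h1, pe_zero]
  rw [hP', tang_pgrad_congr h]
  have : pgrad 0 (x : E3) = 0 := by ext i; simp [pgrad]
  rw [this, ← tangL_apply, map_zero]

theorem eq_of_forall_norm_sub_le {F : Type*} [NormedAddCommGroup F] {a b : F} {M : ℝ}
    (hM : 0 ≤ M) (h : ∀ δ > 0, ‖a - b‖ ≤ M * δ) : a = b := by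
  rw [← sub_eq_zero, ← norm_le_zero_iff]
  refine le_of_forall_pos_le_add fun ε hε => ?_
  refine (h (ε / (M + 1)) (by positivity)).trans ?_
  rw [zero_add, mul_div_assoc', div_le_iff₀ (by positivity)]
  nlinarith

theorem conv_kernelCurl_surfGrad {ψ : ℝ → ℝ} (hψ : Continuous ψ)
    (hint : 2 * Real.pi * ∫ t in (-1 : ℝ)..1, ψ t = 1) {ℓ : ℕ} (hℓ : 1 ≤ ℓ)
    {p : MvPolynomial (Fin 3) ℝ} (hp : p.IsHomogeneous ℓ)
    (hΔ : ∑ i, MvPolynomial.pderiv i (MvPolynomial.pderiv i p) = 0) (x : S2) :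
    conv (kernelCurl ψ) (fun y => tang y (pgrad p y)) x
      = legendreCoeff ψ ℓ • tang x (pgrad p x) := by
  obtain ⟨M, hM0, hM⟩ := exists_abs_legendreCoeff_sub_le hψ hℓ
  have hF := integrable_sphere (continuous_surfGrad_field p)
  have hI : 0 ≤ ∫ y : S2, ‖tang y (pgrad p y)‖ ∂sphereMeasure :=
    integral_nonneg fun _ => norm_nonneg _
  refine eq_of_forall_norm_sub_le (M := 4 * (∫ y : S2, ‖tang y (pgrad p y)‖ ∂sphereMeasure)
    + M * ‖tang x (pgrad p x)‖) (by positivity) fun δ hδ => ?_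
  obtain ⟨G, hG⟩ := exists_legendreClose hψ hint hδ
  have h1 := (hG.kernelClose hψ hint).norm_conv_sub_le (kernelLimit_kernelCurl hψ hint) hF x
  have h2 := mul_le_mul_of_nonneg_right (hM G δ hG) (norm_nonneg (tang x (pgrad p x)))
  rw [conv_kernelPoly_surfGrad hp hΔ] at h1
  rw [← Real.norm_eq_abs, ← norm_smul, sub_smul] at h2
  rw [norm_sub_rev] at h1
  refine (norm_sub_le_norm_sub_add_norm_sub _ _ _).trans ((add_le_add h1 h2).trans_eq ?_)
  ring

theorem conv_kernelCurl_surfCurl {ψ : ℝ → ℝ} (hψ : Continuous ψ)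
    (hint : 2 * Real.pi * ∫ t in (-1 : ℝ)..1, ψ t = 1) (p : MvPolynomial (Fin 3) ℝ) (x : S2) :
    conv (kernelCurl ψ) (fun y => cross y (pgrad p y)) x = 0 := by
  have hF := integrable_sphere (continuous_surfCurl_field p)
  have hI : 0 ≤ ∫ y : S2, ‖cross y (pgrad p y)‖ ∂sphereMeasure :=
    integral_nonneg fun _ => norm_nonneg _
  refine eq_of_forall_norm_sub_le (M := 4 * ∫ y : S2, ‖cross y (pgrad p y)‖ ∂sphereMeasure)
    (by positivity) fun δ hδ => ?_
  obtain ⟨G, hG⟩ := exists_legendreClose hψ hint hδ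
  have h1 := (hG.kernelClose hψ hint).norm_conv_sub_le (kernelLimit_kernelCurl hψ hint) hF x
  rw [conv_kernelPoly_surfCurl, norm_sub_rev] at h1
  exact h1.trans_eq (by ring)

theorem convIntegrand_kernelDiv (ψ : ℝ → ℝ) (f : S2 → E3) (x y : S2) :
    convIntegrand (kernelDiv ψ) f x y
      = crossL x (convIntegrand (kernelCurl ψ) (fun y => cross (f y) y) x y) :=
  mv_kernelDiv ψ x y (f y)

theorem integrable_cross {f : S2 → E3} (hf : Integrable f sphereMeasure) :
    Integrable (fun y : S2 => cross (f y) y) sphereMeasure := by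
  have hc : Continuous fun p : S2 × E3 => cross p.2 p.1 := continuous_cross (by fun_prop) (by fun_prop)
  refine hf.norm.mono' (hc.comp_aestronglyMeasurable
    (continuous_id.aestronglyMeasurable.prodMk hf.1)) (Eventually.of_forall fun y => ?_)
  rw [cross_eq_neg_cross, norm_neg, ← sq_le_sq₀ (norm_nonneg _) (norm_nonneg _),
    ← real_inner_self_eq_norm_sq, inner_cross_cross, real_inner_self_eq_norm_sq]
  exact pow_le_pow_left₀ (norm_nonneg _) (norm_tang_le y _) 2

theorem integrable_convIntegrand_kernelDiv {ψ : ℝ → ℝ} (hk : KernelLimit (kernelCurl ψ))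
    {f : S2 → E3} (hf : Integrable f sphereMeasure) (x : S2) :
    Integrable (convIntegrand (kernelDiv ψ) f x) sphereMeasure := by
  rw [funext (convIntegrand_kernelDiv ψ f x)]
  exact (crossL x).integrable_comp (hk.integrable (integrable_cross hf) x)

theorem conv_kernelDiv {ψ : ℝ → ℝ} (hk : KernelLimit (kernelCurl ψ))
    {f : S2 → E3} (hf : Integrable f sphereMeasure) (x : S2) :
    conv (kernelDiv ψ) f x = cross x (conv (kernelCurl ψ) (fun y => cross (f y) y) x) := by
  rw [conv, funext (convIntegrand_kernelDiv ψ f x),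
    ContinuousLinearMap.integral_comp_comm _ (hk.integrable (integrable_cross hf) x)]
  rfl

end Multipliers

/-! ### The quarter turn and the Helmholtz–Hodge subspaces -/

section Hodge

theorem norm_cross_S2_le (x : S2) (v : E3) : ‖cross x v‖ ≤ ‖v‖ := by
  refine le_trans (le_of_eq ?_) (norm_tang_le x v)
  rw [← sq_eq_sq₀ (norm_nonneg _) (norm_nonneg _), ← real_inner_self_eq_norm_sq, inner_cross_cross,
    real_inner_self_eq_norm_sq]

theorem memLp_cross (u : TangentL2) : MemLp (fun x : S2 => cross x (u.1 x)) 2 sphereMeasure := by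
  have hc : Continuous fun p : S2 × E3 => cross p.1 p.2 := continuous_cross (by fun_prop) (by fun_prop)
  exact (Lp.memLp u.1).mono (hc.comp_aestronglyMeasurable
    (continuous_id.aestronglyMeasurable.prodMk (Lp.aestronglyMeasurable u.1)))
    (Eventually.of_forall fun x => norm_cross_S2_le x _)

/-- The class of the pointwise quarter turn of a tangential field. -/
def quarterTurnFun (u : TangentL2) : TangentL2 :=
  ⟨(memLp_cross u).toLp _, by
    filter_upwards [(memLp_cross u).coeFn_toLp] with x hx
    rw [hx, inner_cross_self_left]⟩

theorem Represents.quarterTurnFun {u : TangentL2} {F : S2 → E3} (hu : Represents u F) :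
    Represents (quarterTurnFun u) (fun x => cross x (F x)) := by
  filter_upwards [(memLp_cross u).coeFn_toLp, hu] with x h1 h2
  rw [← h2]; exact h1

/-- The quarter turn `(J u)(x) = x × u(x)`. -/
def quarterTurn : TangentL2 →L[ℝ] TangentL2 :=
  LinearMap.mkContinuous
    { toFun := quarterTurnFun
      map_add' := fun u v => by
        refine ((represents_self u).add (represents_self v)).quarterTurnFun.ext ?_
        simp only [cross_add_right]
        exact (represents_self u).quarterTurnFun.add (represents_self v).quarterTurnFun
      map_smul' := fun c u => by
        refine ((represents_self u).smul c).quarterTurnFun.ext ?_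
        simp only [cross_smul_right]
        exact (represents_self u).quarterTurnFun.smul c } 1 fun u => by
    rw [one_mul]
    refine Lp.norm_le_norm_of_ae_le ?_
    filter_upwards [(represents_self u).quarterTurnFun] with x hx
    exact hx ▸ norm_cross_S2_le x _

theorem Represents.quarterTurn {u : TangentL2} {F : S2 → E3} (hu : Represents u F) :
    Represents (quarterTurn u) (fun x => cross x (F x)) := hu.quarterTurnFun

theorem inner_quarterTurn_left (u v : TangentL2) :
    inner ℝ (quarterTurn u) v = -inner ℝ u (quarterTurn v) := by
  rw [(represents_self u).quarterTurn.inner_eq (represents_self v),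
    (represents_self u).inner_eq (represents_self v).quarterTurn, ← integral_neg]
  simp only [inner_cross_left]

/-- The class of the surface gradient of a polynomial. -/
def gradClass (p : MvPolynomial (Fin 3) ℝ) : TangentL2 :=
  toTangent (fun y : S2 => tang y (pgrad p y)) (continuous_surfGrad_field p) fun y => inner_tang y _

theorem represents_gradClass (p : MvPolynomial (Fin 3) ℝ) :
    Represents (gradClass p) fun y : S2 => tang y (pgrad p y) := represents_toTangent _ _ _

theorem represents_quarterTurn_gradClass (p : MvPolynomial (Fin 3) ℝ) :
    Represents (quarterTurn (gradClass p)) fun y : S2 => cross y (pgrad p y) := by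
  have h := (represents_gradClass p).quarterTurn
  simpa only [cross_tang] using h

theorem inner_gradClass_of_mem_divFree {v : TangentL2} (hv : v ∈ divFree)
    (p : MvPolynomial (Fin 3) ℝ) : inner ℝ v (gradClass p) = 0 := by
  refine Submodule.inner_left_of_mem_orthogonal (Submodule.subset_span ?_) hv
  refine ⟨pe p, contDiff_pe p, ?_⟩
  rw [funext (surfGrad_pe p)]
  exact represents_gradClass p

theorem inner_quarterTurn_gradClass_of_mem_curlFree {v : TangentL2} (hv : v ∈ curlFree)
    (p : MvPolynomial (Fin 3) ℝ) : inner ℝ v (quarterTurn (gradClass p)) = 0 := by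
  refine Submodule.inner_left_of_mem_orthogonal (Submodule.subset_span ?_) hv
  refine ⟨pe p, contDiff_pe p, ?_⟩
  rw [funext (surfCurl_pe p)]
  exact represents_quarterTurn_gradClass p

/-- The quarter turn is skew, so this pairing is minus that of `∇_* g` with the curl of `p`. Only
one of the two potentials has to be a polynomial. -/
theorem inner_gradClass_of_represents_surfCurl {g : E3 → ℝ} (hg : ContDiff ℝ ∞ g) {w : TangentL2}
    (hw : Represents w (surfCurl fun x => g x)) (p : MvPolynomial (Fin 3) ℝ) :
    inner ℝ w (gradClass p) = 0 := by
  have hg1 : ContDiff ℝ 1 g := hg.of_le (by norm_cast)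
  rw [hw.inner_eq (represents_gradClass p), ← neg_eq_zero, ← integral_neg,
    ← integral_inner_surfGrad_surfCurl hg1 p]
  refine integral_congr_ae (Eventually.of_forall fun x => ?_)
  have hd : DifferentiableAt ℝ g x := hg1.differentiable one_ne_zero x
  simp only [surfCurl_eq x hd]
  rw [inner_cross_left, neg_neg, cross_tang, tang, inner_sub_left, inner_smul_left,
    inner_cross_self_left, mul_zero, sub_zero]

theorem represents_quarterTurn_surfCurl {g : E3 → ℝ} (hg : ContDiff ℝ ∞ g) {w : TangentL2}
    (hw : Represents w (surfGrad fun x => g x)) :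
    Represents (quarterTurn w) (surfCurl fun x => g x) := by
  have e : (surfCurl fun x => g x) = fun x : S2 => cross x (surfGrad (fun y => g y) x) :=
    funext fun x => surfCurl_eq_cross_surfGrad x (hg.differentiable (by simp) x)
  rw [e]
  exact hw.quarterTurn

/-- The range of a limit of polynomial kernels lies in the closure of the gradients. -/
theorem KernelLimit.inner_eq_zero {k : S2 → S2 → Matrix (Fin 3) (Fin 3) ℝ} (hk : KernelLimit k)
    {K : TangentL2 →L[ℝ] TangentL2} (hK : ∀ f, Represents (K f) (conv k f.1)) {v : TangentL2}
    (hv : ∀ p, inner ℝ v (gradClass p) = 0) (f : TangentL2) : inner ℝ v (K f) = 0 := by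
  refine eq_of_forall_norm_sub_le (M := Real.sqrt (4 * Real.pi) * ‖v‖) (by positivity) fun δ hδ => ?_
  obtain ⟨q, hq⟩ := hk.exists_close (integrable_tangent f) hδ
  obtain ⟨P, -, hP⟩ := exists_conv_kernelPoly_eq q (integrable_tangent f) f.2
  have h1 := ((represents_gradClass P).sub (hK f)).norm_le hδ.le fun x => by
    rw [← hP]; exact hq x
  have h2 := abs_real_inner_le_norm v (gradClass P - K f)
  rw [inner_sub_right, hv, zero_sub, abs_neg] at h2
  rw [sub_zero, Real.norm_eq_abs]
  refine h2.trans ((mul_le_mul_of_nonneg_left h1 (norm_nonneg v)).trans_eq ?_)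
  ring

theorem conv_congr_neg {k : S2 → S2 → Matrix (Fin 3) (Fin 3) ℝ} {f g : S2 → E3}
    (h : ∀ᵐ y ∂sphereMeasure, f y = -g y) (x : S2) : conv k f x = -conv k g x := by
  rw [conv, conv, ← integral_neg]
  refine integral_congr_ae ?_
  filter_upwards [h] with y hy
  rw [convIntegrand_eq, hy, ← neg_one_smul ℝ (g y), mv_smul_right, neg_one_smul]; rfl

/-- The conjugation formula feeds `f × y = -J f` into the curl-free kernel and then applies `J`;
this is where the sign comes from. -/
theorem represents_divOp {ψ : ℝ → ℝ} (hk : KernelLimit (kernelCurl ψ))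
    {K : TangentL2 →L[ℝ] TangentL2} (hK : ∀ f, Represents (K f) (conv (kernelCurl ψ) f.1))
    (f : TangentL2) :
    Represents ((-(quarterTurn ∘L K ∘L quarterTurn)) f) (conv (kernelDiv ψ) f.1) := by
  have h := ((hK (quarterTurn f)).quarterTurn).smul (-1)
  rw [neg_one_smul] at h
  refine Eq.mp (congrArg _ (funext fun x => ?_)) h
  symm
  rw [conv_kernelDiv hk (integrable_tangent f), conv_congr_neg (g := (quarterTurn f).1.1) ?_ x,
    ← neg_one_smul ℝ (conv _ _ _), cross_smul_right]
  filter_upwards [(represents_self f).quarterTurn] with y hy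
  rw [hy, ← cross_eq_neg_cross]

end Hodge

/-! ### Projections and the main theorem -/

section Main

/-- The projection onto a subspace containing the range of a symmetric operator `A` and orthogonal
to the range of a symmetric operator `B`. -/
theorem starProjection_add_of_symmetric {H : Type*} [NormedAddCommGroup H] [InnerProductSpace ℝ H]
    (A B : H →L[ℝ] H) (hA : ∀ f g, inner ℝ (A f) g = inner ℝ f (A g))
    (hB : ∀ f g, inner ℝ (B f) g = inner ℝ f (B g)) (S : Submodule ℝ H)
    [S.HasOrthogonalProjection] (hAS : ∀ f, A f ∈ S) (hBS : ∀ v ∈ S, ∀ f, inner ℝ v (B f) = 0)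
    (f : H) : S.starProjection ((A + B) f) = A f ∧ (A + B) (S.starProjection f) = A f := by
  -- A symmetric operator vanishes on the orthogonal complement of its range.
  have hzero : ∀ T : H →L[ℝ] H, (∀ f g, inner ℝ (T f) g = inner ℝ f (T g)) →
      ∀ g, (∀ f, inner ℝ g (T f) = 0) → T g = 0 := fun T hT g hg => by
    rw [← inner_self_eq_zero (𝕜 := ℝ), hT, hg]
  constructor
  · refine Submodule.eq_starProjection_of_mem_of_inner_eq_zero (hAS f) fun w hw => ?_
    rw [add_apply, add_sub_cancel_left, real_inner_comm]
    exact hBS w hw f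
  · have e1 : B (S.starProjection f) = 0 := hzero B hB _ fun g =>
      hBS _ (Submodule.starProjection_apply_mem _ f) g
    have e2 : A (f - S.starProjection f) = 0 := hzero A hA _ fun g => by
      rw [real_inner_comm]
      exact Submodule.inner_right_of_mem_orthogonal (hAS g)
        (Submodule.sub_starProjection_mem_orthogonal f)
    rw [map_sub, sub_eq_zero] at e2
    rw [add_apply, e1, add_zero, e2]

theorem exists_vsh_eq {Y : (ℓ : ℕ) → Fin (2 * ℓ + 1) → S2 → ℝ} (hY : IsSphericalHarmonicBasis Y)
    (ℓ : ℕ) (k : Fin (2 * ℓ + 1)) : ∃ p : MvPolynomial (Fin 3) ℝ, p.IsHomogeneous ℓ ∧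
      ∑ i, MvPolynomial.pderiv i (MvPolynomial.pderiv i p) = 0 ∧
      vshY Y ℓ k = (fun x : S2 => cross x (pgrad p x)) ∧
      vshZ Y ℓ k = fun x : S2 => tang x (pgrad p x) := by
  have hmem : Y ℓ k ∈ sphericalHarmonics ℓ := by
    rw [← hY.span_eq]; exact Submodule.subset_span ⟨k, rfl⟩
  obtain ⟨p, hp, hΔ, hpe⟩ := hmem
  have hYp : Y ℓ k = fun x : S2 => pe p x := funext hpe
  set s := (Real.sqrt ((ℓ : ℝ) * ((ℓ : ℝ) + 1)))⁻¹ with hs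
  refine ⟨MvPolynomial.C s * p, ?_, ?_, ?_, ?_⟩
  · simpa using (MvPolynomial.isHomogeneous_C (Fin 3) s).mul hp
  · simp [← Finset.mul_sum, hΔ]
  · ext1 x
    rw [vshY, hYp, surfCurl_pe, pgrad_C_mul, cross_smul_right]
  · ext1 x
    rw [vshZ, hYp, surfGrad_pe, pgrad_C_mul, tang_smul]

theorem conv_kernelDiv_surfCurl {ψ : ℝ → ℝ} (hψ : Continuous ψ)
    (hint : 2 * Real.pi * ∫ t in (-1 : ℝ)..1, ψ t = 1) {ℓ : ℕ} (hℓ : 1 ≤ ℓ)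
    {p : MvPolynomial (Fin 3) ℝ} (hp : p.IsHomogeneous ℓ)
    (hΔ : ∑ i, MvPolynomial.pderiv i (MvPolynomial.pderiv i p) = 0) (x : S2) :
    conv (kernelDiv ψ) (fun y => cross y (pgrad p y)) x
      = legendreCoeff ψ ℓ • cross x (pgrad p x) := by
  have e : (fun y : S2 => cross (cross y (pgrad p y)) y) = fun y : S2 => tang y (pgrad p y) := by
    ext1 y
    rw [cross_eq_neg_cross, cross_cross_self, neg_neg]
  rw [conv_kernelDiv (kernelLimit_kernelCurl hψ hint)
    (integrable_sphere (continuous_surfCurl_field p)), e,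
    conv_kernelCurl_surfGrad hψ hint hℓ hp hΔ, cross_smul_right, cross_tang]

theorem conv_kernelDiv_surfGrad {ψ : ℝ → ℝ} (hψ : Continuous ψ)
    (hint : 2 * Real.pi * ∫ t in (-1 : ℝ)..1, ψ t = 1)
    (p : MvPolynomial (Fin 3) ℝ) (x : S2) :
    conv (kernelDiv ψ) (fun y => tang y (pgrad p y)) x = 0 := by
  rw [conv_kernelDiv (kernelLimit_kernelCurl hψ hint)
    (integrable_sphere (continuous_surfGrad_field p)),
    conv_congr_neg (g := fun y : S2 => cross y (pgrad p y)) (Eventually.of_forall fun y => by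
      rw [cross_eq_neg_cross, cross_tang]),
    conv_kernelCurl_surfCurl hψ hint, neg_zero, ← crossL_apply, map_zero]

theorem conv_kernelSum {ψ : ℝ → ℝ} (hk : KernelLimit (kernelCurl ψ)) {f : S2 → E3}
    (hf : Integrable f sphereMeasure) (x : S2) :
    Integrable (convIntegrand (kernelSum ψ) f x) sphereMeasure ∧
      conv (kernelSum ψ) f x = conv (kernelDiv ψ) f x + conv (kernelCurl ψ) f x := by
  have e : convIntegrand (kernelSum ψ) f x
      = fun y => convIntegrand (kernelDiv ψ) f x y + convIntegrand (kernelCurl ψ) f x y :=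
    funext fun y => mv_add_left _ _ _
  have h1 := integrable_convIntegrand_kernelDiv hk hf x
  have h2 := hk.integrable hf x
  rw [conv, e]
  exact ⟨h1.add h2, integral_add h1 h2⟩

end Main

set_option maxHeartbeats 1000000 in
theorem mainTheorem2
    (φ : ℝ → ℝ) (hφ : ContinuousOn φ (Set.Ici 0))
    (ρ : ℝ) (hρ0 : 0 < ρ) (hρ1 : ρ < 1)
    (C : ℝ)
    (ψ : ℝ → ℝ) (hψ : ψ = scaledKernel φ C ρ)
    (hC : ∀ y : S2,
      ∫ x : S2, ψ (inner ℝ (x : E3) (y : E3)) ∂sphereMeasure = 1)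
    (Y : (ℓ : ℕ) → Fin (2 * ℓ + 1) → S2 → ℝ) (hY : IsSphericalHarmonicBasis Y) :
    -- the convolution is a bounded linear operator on the tangential square integrable fields
    ∃ T : TangentL2 →L[ℝ] TangentL2,
      (∀ f : TangentL2,
        (∀ x, Integrable (convIntegrand (kernelSum ψ) f.1 x) sphereMeasure) ∧
        Represents (T f) (conv (kernelSum ψ) f.1)) ∧
      -- it is a simple multiplier with factors the Fourier–Legendre coefficients
      IsSimpleFourierLegendreMultiplier Y T
        (legendreCoeff ψ) (legendreCoeff ψ) ∧
      -- the action on the vector spherical harmonics holds at every point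
      (∀ ℓ, 1 ≤ ℓ → ∀ k x,
        conv (kernelSum ψ) (vshY Y ℓ k) x
          = legendreCoeff ψ ℓ • vshY Y ℓ k x ∧
        conv (kernelSum ψ) (vshZ Y ℓ k) x
          = legendreCoeff ψ ℓ • vshZ Y ℓ k x) ∧
      -- the action on the Fourier–Legendre coefficients of an arbitrary field
      (∀ f : TangentL2, ∀ ℓ, 1 ≤ ℓ → ∀ k,
        ∫ x, inner ℝ ((T f).1 x) (vshY Y ℓ k x) ∂sphereMeasure
          = legendreCoeff ψ ℓ
            * ∫ x, inner ℝ (f.1 x) (vshY Y ℓ k x) ∂sphereMeasure ∧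
        ∫ x, inner ℝ ((T f).1 x) (vshZ Y ℓ k x) ∂sphereMeasure
          = legendreCoeff ψ ℓ
            * ∫ x, inner ℝ (f.1 x) (vshZ Y ℓ k x) ∂sphereMeasure) ∧
      -- it respects the Helmholtz–Hodge decomposition
      (∀ f : TangentL2,
        projDiv (T f) = T (projDiv f) ∧ Represents (projDiv (T f)) (conv (kernelDiv ψ) f.1) ∧
        projCurl (T f) = T (projCurl f) ∧ Represents (projCurl (T f)) (conv (kernelCurl ψ) f.1)) := by
  have hψc : Continuous ψ := hψ ▸ continuous_scaledKernel hφ C hρ0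
  -- By the hat-box theorem, the normalisation at any single point fixes the mean of `ψ` on
  -- `[-1,1]`.
  have hint : 2 * Real.pi * ∫ t in (-1 : ℝ)..1, ψ t = 1 := by
    have a : S2 := ⟨basisVec 0, by simp⟩
    rw [← integral_zonal_of_continuous hψc a, ← hC a]
    simp only [real_inner_comm]
  have hk := kernelLimit_kernelCurl hψc hint
  obtain ⟨K, hK⟩ := hk.exists_op
  set D : TangentL2 →L[ℝ] TangentL2 := -(quarterTurn ∘L K ∘L quarterTurn) with hD
  have hDr : ∀ f, Represents (D f) (conv (kernelDiv ψ) f.1) := represents_divOp hk hK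
  have hDi : ∀ v f, inner ℝ v (D f) = inner ℝ (quarterTurn v) (K (quarterTurn f)) := fun v f => by
    rw [inner_quarterTurn_left, hD]
    simp
  have hKs : ∀ f g, inner ℝ (K f) g = inner ℝ f (K g) := hk.symm hK
  have hDs : ∀ f g, inner ℝ (D f) g = inner ℝ f (D g) := fun f g => by
    rw [hDi, ← hKs, real_inner_comm, hDi, real_inner_comm]
  have hTr : ∀ f, Represents ((D + K) f) (conv (kernelSum ψ) f.1) := fun f => by
    rw [funext fun x => (conv_kernelSum hk (integrable_tangent f) x).2]
    exact (hDr f).add (hK f)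
  have hTs : ∀ f g, inner ℝ ((D + K) f) g = inner ℝ f ((D + K) g) := fun f g => by
    rw [add_apply, add_apply, inner_add_left, inner_add_right, hDs, hKs]
  have hKdiv : ∀ v ∈ divFree, ∀ f, inner ℝ v (K f) = 0 := fun v hv f =>
    hk.inner_eq_zero hK (inner_gradClass_of_mem_divFree hv) f
  -- For curl-free `v`, the turned field `J v` is orthogonal to polynomial gradients, and the
  -- pairing becomes one with the range of `K`.
  have hDcurl : ∀ v ∈ curlFree, ∀ f, inner ℝ v (D f) = 0 := fun v hv f => by
    rw [hDi]
    refine hk.inner_eq_zero hK (fun p => ?_) _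
    rw [inner_quarterTurn_left, inner_quarterTurn_gradClass_of_mem_curlFree hv, neg_zero]
  -- Smooth surface curls are orthogonal to polynomial gradients and hence to their limits, which
  -- include the range of `K`.
  have hKmem : ∀ f, K f ∈ curlFree := fun f => by
    rw [curlFree, Submodule.mem_orthogonal]
    intro u hu
    induction hu using Submodule.span_induction with
    | mem u hu =>
      obtain ⟨g, hg, hr⟩ := hu
      exact hk.inner_eq_zero hK (inner_gradClass_of_represents_surfCurl hg hr) f
    | zero => exact inner_zero_left _
    | add u v _ _ h1 h2 => rw [inner_add_left, h1, h2, add_zero]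
    | smul c u _ h => rw [inner_smul_left, h, mul_zero]
  -- Since `J ∇_* g = L_* g`, pairing `∇_* g` with `D f` amounts to pairing a surface curl with the
  -- range of `K`.
  have hDmem : ∀ f, D f ∈ divFree := fun f => by
    rw [divFree, Submodule.mem_orthogonal]
    intro u hu
    induction hu using Submodule.span_induction with
    | mem u hu =>
      obtain ⟨g, hg, hr⟩ := hu
      rw [hDi]
      exact hk.inner_eq_zero hK
        (inner_gradClass_of_represents_surfCurl hg (represents_quarterTurn_surfCurl hg hr)) _
    | zero => exact inner_zero_left _
    | add u v _ _ h1 h2 => rw [inner_add_left, h1, h2, add_zero]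
    | smul c u _ h => rw [inner_smul_left, h, mul_zero]
  have hpt : ∀ ℓ, 1 ≤ ℓ → ∀ k x,
      conv (kernelSum ψ) (vshY Y ℓ k) x = legendreCoeff ψ ℓ • vshY Y ℓ k x ∧
      conv (kernelSum ψ) (vshZ Y ℓ k) x = legendreCoeff ψ ℓ • vshZ Y ℓ k x := fun ℓ hℓ k x => by
    obtain ⟨p, hp, hΔ, hy, hz⟩ := exists_vsh_eq hY ℓ k
    rw [hy, hz]
    constructor
    · rw [(conv_kernelSum hk (integrable_sphere (continuous_surfCurl_field p)) x).2,
        conv_kernelDiv_surfCurl hψc hint hℓ hp hΔ, conv_kernelCurl_surfCurl hψc hint, add_zero]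
    · rw [(conv_kernelSum hk (integrable_sphere (continuous_surfGrad_field p)) x).2,
        conv_kernelCurl_surfGrad hψc hint hℓ hp hΔ, conv_kernelDiv_surfGrad hψc hint, zero_add]
  -- The convolution integral depends only on the class of `F`, so pointwise eigenvalue identities
  -- pass to `TangentL2`.
  have hev : ∀ {F : S2 → E3} {c : ℝ}, (∀ x, conv (kernelSum ψ) F x = c • F x) →
      ∀ {u : TangentL2}, Represents u F → (D + K) u = c • u := fun {F c} hF {u} hu => by
    refine (hTr u).ext ((hu.smul c).trans (Eventually.of_forall fun x => ?_))
    simp only [← hF]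
    refine integral_congr_ae ?_
    filter_upwards [hu] with y hy
    rw [convIntegrand_eq, convIntegrand_eq, hy]
  have hrep : ∀ ℓ k, ∃ u v : TangentL2, Represents u (vshY Y ℓ k) ∧ Represents v (vshZ Y ℓ k) :=
    fun ℓ k => by
      obtain ⟨p, -, -, hy, hz⟩ := exists_vsh_eq hY ℓ k
      rw [hy, hz]
      exact ⟨_, _, represents_quarterTurn_gradClass p, represents_gradClass p⟩
  refine ⟨D + K, fun f => ⟨fun x => (conv_kernelSum hk (integrable_tangent f) x).1, hTr f⟩, ?_, hpt,
    ?_, ?_⟩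
  · intro ℓ hℓ k
    obtain ⟨u, v, hu, hv⟩ := hrep ℓ k
    exact ⟨⟨u, hu, hev (fun x => (hpt ℓ hℓ k x).1) hu⟩, ⟨v, hv, hev (fun x => (hpt ℓ hℓ k x).2) hv⟩⟩
  · intro f ℓ hℓ k
    obtain ⟨u, v, hu, hv⟩ := hrep ℓ k
    -- Symmetry moves the operator onto the vector spherical harmonic, an eigenvector.
    have h1 := hTs f u
    have h2 := hTs f v
    rw [hev (fun x => (hpt ℓ hℓ k x).1) hu, (represents_self _).inner_eq hu,
      (represents_self f).inner_eq (hu.smul _)] at h1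
    rw [hev (fun x => (hpt ℓ hℓ k x).2) hv, (represents_self _).inner_eq hv,
      (represents_self f).inner_eq (hv.smul _)] at h2
    simp only [inner_smul_right, integral_const_mul] at h1 h2
    exact ⟨h1, h2⟩
  · intro f
    obtain ⟨hPD, h1⟩ := starProjection_add_of_symmetric D K hDs hKs divFree hDmem hKdiv f
    obtain ⟨hPC, h2⟩ := starProjection_add_of_symmetric K D hKs hDs curlFree hKmem hDcurl f
    have hPD' : projDiv ((D + K) f) = D f := hPD
    have hPC' : projCurl ((D + K) f) = K f := by rw [add_comm]; exact hPC
    have h1' : (D + K) (projDiv f) = D f := h1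
    have h2' : (D + K) (projCurl f) = K f := by rw [add_comm]; exact h2
    refine ⟨hPD'.trans h1'.symm, ?_, hPC'.trans h2'.symm, ?_⟩
    · rw [hPD']; exact hDr f
    · rw [hPC']; exact hK f

end
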